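/- Let $\mathbf{k}$ be a field, $G$ a finite abelian group, $n\ge 0$, $g_1,\dots,g_n\in G$, and let $\chi_1,\dots,\chi_n\colon G\to\mathbf{k}^*$ be characters. Put $q_{ij}=\chi_j(g_i)$ and assume $q_{ii}\ne 1$ for all $i$ and $q_{ij}q_{ji}=1$ for $i\ne j$. Let $m_i$ be the order of $q_{ii}$. Let $\lambda_i\in\mathbf{k}$ and $\lambda_{ij}\in\mathbf{k}$ ($i\neq j$) satisfy $\lambda_i(\chi_i(h)^{m_i}-1)=0$ and $\lambda_{ij}(\chi_i(h)\chi_j(h)-1)=0$ for all $h\in G$, and $\lambda_{ij}+q_{ij}\lambda_{ji}=0$ for $i\ne j$. Let $H$ be the corresponding lifting of a quantum linear space, that is, the $\mathbf{k}$-algebra generated by $G$ (with the relations of $G$) and $x_1,\dots,x_n$, subject to $$gx_i=\chi_i(g)x_ig,\qquad x_ix_j=q_{ij}x_jx_i+\lambda_{ij}(1-g_ig_j)\ (i\neq j),\qquad x_i^{m_i}=\lambda_i(1-g_i^{m_i}),$$ with comultiplication $\Delta(g)=g\otimes g$, $\Delta(x_i)=g_i\otimes x_i+x_i\otimes 1$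 and counit $\varepsilon(g)=1$, $\varepsilon(x_i)=0$. A right integral in $H^*$ is a $\varphi\in H^*$ with $\varphi(h_{(1)})f(h_{(2)})=f(1)\varphi(h)$ for all $f\in H^*$, $h\in H$; a right integral in $H$ is a $t\in H$ with $th=\varepsilon(h)t$ for all $h\in H$; a modular element is an $\alpha\in H^*$ such that $ht=\alpha(h)t$ for all $h\in H$ and some nonzero right integral $t$ in $H$. Then: 1. $H^*$ has a nonzero right integral, and $H$ has a modular element. 2. The elements $(x_1g_1^{-1})^{r_1}\cdots(x_ng_n^{-1})^{r_n}g$ with $0\le r_i<m_i$ and $g\in G$ form a basis of $H$. 3. For every nonzero right integral $\varphi\in H^*$, the map $H\to H^*$, $x\mapsto\varphi(\,\cdot\,x)$, is bijective, and there is exactly one algebra automorphism $\rho$ of $H$ (the Nakayama automorphism) with $\varphi(yx)=\varphi(\rho(x)y)$ for all $x,y\in H$. For this $\rho$: - (a) every basis element in 2 is an eigenvector of $\rho$, and the map sending $(r_1,\dots,r_n,g)$ to the eigenvalue of $(x_1g_1^{-1})^{r_1}\cdots(x_ng_n^{-1})^{r_n}g$ is a group homomorphism $\theta\colon\mathbb{Z}_{m_1}\times\cdots\times\mathbb{Z}_{m_n}\times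 G\to\mathbf{k}^*$; - (b) for every modular element $\alpha$, the set of eigenvalues of $\rho$ is the subgroup $L_1=\langle q_{11},\dots,q_{nn},\alpha(G)\rangle$ of $\mathbf{k}^*$, $H=\bigoplus_{\omega\in L_1}H_\omega$ with $H_\omega=\{h\in H:\rho(h)=\omega h\}$, and all the eigenspaces $H_\omega$, $\omega\in L_1$, have the same dimension. -/

import Mathlib

open scoped TensorProduct

/-! ### A `q`-binomial identity

If `A * B = q • (B * A)` and `q` is a primitive `m`-th root of unity, then
`(B + A) ^ m = B ^ m + A ^ m`.  It is needed for the comultiplication to be well defined. -/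

/-- Gaussian binomial coefficients at `q`, by the Pascal recursion. -/
def gaussBinom {k : Type*} [Field k] (q : k) : ℕ → ℕ → k
  | _, 0 => 1
  | 0, _ + 1 => 0
  | n + 1, j + 1 => gaussBinom q n j + q ^ (j + 1) * gaussBinom q n (j + 1)

theorem gaussBinom_zero_right {k : Type*} [Field k] (q : k) (n : ℕ) :
    gaussBinom q n 0 = 1 := by
  cases n <;> rfl

theorem gaussBinom_succ_succ {k : Type*} [Field k] (q : k) (n j : ℕ) :
    gaussBinom q (n + 1) (j + 1)
      = gaussBinom q n j + q ^ (j + 1) * gaussBinom q n (j + 1) := rfl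

theorem gaussBinom_of_lt {k : Type*} [Field k] (q : k) (n : ℕ) :
    ∀ j, n < j → gaussBinom q n j = 0 := by
  induction n with
  | zero => intro j hj; cases j with
    | zero => omega
    | succ j => rfl
  | succ n ih => intro j hj; cases j with
    | zero => omega
    | succ j => rw [gaussBinom_succ_succ, ih j (by omega), ih (j + 1) (by omega)]; ring

theorem gaussBinom_self {k : Type*} [Field k] (q : k) (n : ℕ) :
    gaussBinom q n n = 1 := by
  induction n with
  | zero => rfl
  | succ n ih => rw [gaussBinom_succ_succ, ih, gaussBinom_of_lt q n (n + 1) (by omega)]; ring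

theorem gaussBinom_absorb {k : Type*} [Field k] (q : k) (n : ℕ) :
    ∀ j, (1 - q ^ (j + 1)) * gaussBinom q (n + 1) (j + 1)
      = (1 - q ^ (n + 1)) * gaussBinom q n j := by
  induction n with
  | zero =>
    intro j
    cases j with
    | zero => simp [gaussBinom]
    | succ j => simp [gaussBinom]
  | succ n ih =>
    intro j
    rw [gaussBinom_succ_succ q (n + 1) j]
    cases j with
    | zero =>
      have h := ih 0
      simp only [gaussBinom_zero_right] at h ⊢
      linear_combination q ^ (0 + 1) * h
    | succ j =>
      have h1 := ih (j + 1)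
      have h2 := ih j
      have h3 := gaussBinom_succ_succ q n j
      linear_combination q ^ (j + 1 + 1) * h1 + q * h2 - (q - q ^ (n + 2)) * h3

theorem qcomm_mul_pow {k E : Type*} [Field k] [Ring E] [Algebra k E] {q : k} {A B : E}
    (h : A * B = q • (B * A)) (j : ℕ) : A * B ^ j = q ^ j • (B ^ j * A) := by
  induction j with
  | zero => simp
  | succ j ih =>
    rw [pow_succ, ← mul_assoc, ih, smul_mul_assoc, mul_assoc, h, mul_smul_comm, smul_smul,
      ← mul_assoc, pow_succ]

theorem qcomm_add_pow {k E : Type*} [Field k] [Ring E] [Algebra k E] {q : k} {A B : E}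
    (h : A * B = q • (B * A)) (n : ℕ) :
    (B + A) ^ n = ∑ j ∈ Finset.range (n + 1), gaussBinom q n j • (B ^ j * A ^ (n - j)) := by
  induction n with
  | zero => simp [gaussBinom]
  | succ n ih =>
    rw [pow_succ', ih, add_mul, Finset.mul_sum, Finset.mul_sum, Finset.sum_range_succ' _ (n + 1)]
    have hB : ∀ j ∈ Finset.range (n + 1), B * gaussBinom q n j • (B ^ j * A ^ (n - j))
        = gaussBinom q n j • (B ^ (j + 1) * A ^ (n + 1 - (j + 1))) := by
      intro j _
      rw [mul_smul_comm, ← mul_assoc, ← pow_succ', Nat.add_sub_add_right]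
    have hA : ∀ j ∈ Finset.range (n + 1), A * gaussBinom q n j • (B ^ j * A ^ (n - j))
        = (q ^ j * gaussBinom q n j) • (B ^ j * A ^ (n + 1 - j)) := by
      intro j hj
      rw [Finset.mem_range] at hj
      rw [mul_smul_comm, ← mul_assoc, qcomm_mul_pow h, smul_mul_assoc, mul_assoc, ← pow_succ',
        smul_smul, mul_comm, show n - j + 1 = n + 1 - j by omega]
    rw [Finset.sum_congr rfl hB, Finset.sum_congr rfl hA,
      Finset.sum_range_succ' (fun j => (q ^ j * gaussBinom q n j) • (B ^ j * A ^ (n + 1 - j))) n]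
    have hs : ∑ j ∈ Finset.range (n + 1), gaussBinom q (n + 1) (j + 1) •
          (B ^ (j + 1) * A ^ (n + 1 - (j + 1)))
        = ∑ j ∈ Finset.range (n + 1), gaussBinom q n j • (B ^ (j + 1) * A ^ (n + 1 - (j + 1)))
        + ∑ j ∈ Finset.range n, (q ^ (j + 1) * gaussBinom q n (j + 1)) •
          (B ^ (j + 1) * A ^ (n + 1 - (j + 1))) := by
      simp only [gaussBinom_succ_succ, add_smul, Finset.sum_add_distrib]
      congr 1
      rw [Finset.sum_range_succ, gaussBinom_of_lt q n (n + 1) (by omega)]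
      simp
    rw [hs]
    simp only [gaussBinom_zero_right, pow_zero, mul_one]
    rw [add_assoc]

theorem qcomm_add_pow_orderOf {k E : Type*} [Field k] [Ring E] [Algebra k E] {q : kˣ} {A B : E}
    (h : A * B = (q : k) • (B * A)) (hq : 0 < orderOf q) :
    (B + A) ^ orderOf q = A ^ orderOf q + B ^ orderOf q := by
  obtain ⟨m, hm⟩ : ∃ m, orderOf q = m + 1 := ⟨orderOf q - 1, by omega⟩
  have hq1 : (q : k) ^ (m + 1) = 1 := by
    rw [← hm, ← Units.val_pow_eq_pow_val, pow_orderOf_eq_one, Units.val_one]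
  rw [qcomm_add_pow h, hm, Finset.sum_range_succ, Finset.sum_range_succ', gaussBinom_self]
  have hz : ∀ j ∈ Finset.range m, gaussBinom (q : k) (m + 1) (j + 1) •
      (B ^ (j + 1) * A ^ (m + 1 - (j + 1))) = 0 := by
    intro j hj
    rw [Finset.mem_range] at hj
    have h1 := gaussBinom_absorb (q : k) m j
    rw [hq1, sub_self, zero_mul] at h1
    have h2 : (1 : k) - (q : k) ^ (j + 1) ≠ 0 := by
      intro h0
      have h3 : q ^ (j + 1) = 1 := by
        ext
        push_cast
        exact (sub_eq_zero.mp h0).symm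
      exact pow_ne_one_of_lt_orderOf (by omega) (by omega) h3
    rw [(mul_eq_zero.mp h1).resolve_left h2, zero_smul]
  rw [Finset.sum_eq_zero hz]
  simp [gaussBinom_zero_right]

/-! ### Integrals, Frobenius homomorphisms, Nakayama automorphisms -/

/-- `φ` is a Frobenius homomorphism of `A`: the map `x ↦ xφ` from `A` to its dual,
`(xφ)(y) = φ (y x)`, is bijective (it is always a homomorphism of left `A`-modules). -/
def IsFrobeniusHom {k A : Type*} [Field k] [Ring A] [Algebra k A] (φ : Module.Dual k A) : Prop :=
  Function.Bijective fun x : A => (φ ∘ₗ LinearMap.mulRight k x : Module.Dual k A)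

/-- `ρ` is the Nakayama automorphism of `A` with respect to `φ`: `xφ = φρ(x)` for all `x`, where
`(xφ)(y) = φ (y x)` and `(φx)(y) = φ (x y)`. -/
def IsNakayamaAut {k A : Type*} [Field k] [Ring A] [Algebra k A] (φ : Module.Dual k A)
    (ρ : A ≃ₐ[k] A) : Prop :=
  ∀ x y : A, φ (y * x) = φ (ρ x * y)

/-- `φ` is a right integral in the dual algebra of `A`: `φ * f = f(1) φ` for all `f`, with the
convolution product `(φ * f)(a) = φ(a₁) f(a₂)`. -/
def IsRightIntegralDual {k A : Type*} [Field k] [Ring A] [Bialgebra k A]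
    (φ : Module.Dual k A) : Prop :=
  ∀ f : Module.Dual k A,
    LinearMap.mul' k k ∘ₗ TensorProduct.map φ f ∘ₗ Coalgebra.comul = f 1 • φ

/-- `t` is a right integral in `A`. -/
def IsRightIntegral {k A : Type*} [Field k] [Ring A] [Bialgebra k A] (t : A) : Prop :=
  ∀ a : A, t * a = Coalgebra.counit (R := k) a • t

/-- `α` is the modular element of `A`: `a t = α(a) t` for a nonzero right integral `t` in `A`. -/
def IsModularElement {k A : Type*} [Field k] [Ring A] [Bialgebra k A]
    (α : Module.Dual k A) : Prop :=
  ∃ t : A, t ≠ 0 ∧ IsRightIntegral (k := k) t ∧ ∀ a : A, a * t = α a • t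

/-! ### Liftings of quantum linear spaces -/

/-- The data `(𝐠, χ, λ)` defining a lifting of a quantum linear space over the abelian group `G`.
The diagonal values `lamLink i i` play no role. -/
structure LiftingDatum (k G : Type*) [Field k] [CommGroup G] (n : ℕ) where
  g : Fin n → G
  χ : Fin n → (G →* kˣ)
  lam : Fin n → k
  lamLink : Fin n → Fin n → k
  χ_self_ne_one : ∀ i, χ i (g i) ≠ 1
  χ_mul_χ : ∀ i j, i ≠ j → χ i (g j) * χ j (g i) = 1
  lam_mul : ∀ i (h : G), lam i * ((χ i h : k) ^ orderOf (χ i (g i)) - 1) = 0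
  lamLink_mul : ∀ i j, i ≠ j → ∀ h : G, lamLink i j * ((χ i h : k) * (χ j h : k) - 1) = 0
  lamLink_add : ∀ i j, i ≠ j → lamLink i j + (χ j (g i) : k) * lamLink j i = 0

namespace LiftingDatum

variable {k G : Type*} [Field k] [CommGroup G] {n : ℕ} (D : LiftingDatum k G n)

/-- The braiding scalars `q i j = χ_j(g_i)`. -/
def q (i j : Fin n) : kˣ := D.χ j (D.g i)

/-- `m i` is the order of `q i i`. -/
noncomputable def m (i : Fin n) : ℕ := orderOf (D.q i i)

/-- Generator of the free algebra attached to a group element. -/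
def fg (_ : LiftingDatum k G n) (h : G) : FreeAlgebra k (G ⊕ Fin n) := FreeAlgebra.ι k (Sum.inl h)

/-- Generator of the free algebra attached to an index. -/
def fx (_ : LiftingDatum k G n) (i : Fin n) : FreeAlgebra k (G ⊕ Fin n) :=
  FreeAlgebra.ι k (Sum.inr i)

/-- The defining relations: those of the group `G`, and the three families of relations
involving the `x_i`. -/
inductive Rel : FreeAlgebra k (G ⊕ Fin n) → FreeAlgebra k (G ⊕ Fin n) → Prop
  | one : Rel (D.fg 1) 1
  | mul (a b : G) : Rel (D.fg (a * b)) (D.fg a * D.fg b)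
  | comm (h : G) (i : Fin n) : Rel (D.fg h * D.fx i) ((D.χ i h : k) • (D.fx i * D.fg h))
  | link (i j : Fin n) (hij : i ≠ j) : Rel (D.fx i * D.fx j)
      ((D.q i j : k) • (D.fx j * D.fx i) + D.lamLink i j • (1 - D.fg (D.g i * D.g j)))
  | power (i : Fin n) : Rel (D.fx i ^ D.m i) (D.lam i • (1 - D.fg (D.g i ^ D.m i)))

/-- The lifting `H(𝐠, χ, λ)`, as an algebra given by generators and relations. -/
def H : Type _ := RingQuot D.Rel

noncomputable instance : Ring D.H := inferInstanceAs (Ring (RingQuot D.Rel))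

noncomputable instance : Algebra k D.H := inferInstanceAs (Algebra k (RingQuot D.Rel))

/-- The quotient map from the free algebra. -/
noncomputable def proj : FreeAlgebra k (G ⊕ Fin n) →ₐ[k] D.H := RingQuot.mkAlgHom k D.Rel

/-- The group elements of `H`. -/
noncomputable def grp : G →* D.H where
  toFun h := D.proj (D.fg h)
  map_one' := (RingQuot.mkAlgHom_rel k Rel.one).trans (map_one D.proj)
  map_mul' a b := (RingQuot.mkAlgHom_rel k (Rel.mul a b)).trans (map_mul D.proj _ _)

/-- The generators `x_i` of `H`. -/
noncomputable def x (i : Fin n) : D.H := D.proj (D.fx i)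

theorem proj_rel {a b : FreeAlgebra k (G ⊕ Fin n)} (h : D.Rel a b) : D.proj a = D.proj b :=
  RingQuot.mkAlgHom_rel k h

theorem grp_mul_x (h : G) (i : Fin n) :
    D.grp h * D.x i = (D.χ i h : k) • (D.x i * D.grp h) := by
  have := D.proj_rel (Rel.comm h i)
  rw [map_smul, map_mul, map_mul] at this
  exact this

theorem x_mul_x {i j : Fin n} (hij : i ≠ j) :
    D.x i * D.x j = (D.q i j : k) • (D.x j * D.x i)
      + D.lamLink i j • (1 - D.grp (D.g i * D.g j)) := by
  have := D.proj_rel (Rel.link i j hij)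
  rw [map_add, map_smul, map_smul, map_mul, map_mul, map_sub, map_one] at this
  exact this

theorem x_pow (i : Fin n) : D.x i ^ D.m i = D.lam i • (1 - D.grp (D.g i ^ D.m i)) := by
  have := D.proj_rel (Rel.power i)
  rw [map_pow, map_smul, map_sub, map_one] at this
  exact this

/-- The universal property of `H`. -/
noncomputable def lift {E : Type*} [Ring E] [Algebra k E] (γ : G →* E) (ξ : Fin n → E)
    (hcomm : ∀ h i, γ h * ξ i = (D.χ i h : k) • (ξ i * γ h))
    (hlink : ∀ i j, i ≠ j → ξ i * ξ j
      = (D.q i j : k) • (ξ j * ξ i) + D.lamLink i j • (1 - γ (D.g i * D.g j)))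
    (hpow : ∀ i, ξ i ^ D.m i = D.lam i • (1 - γ (D.g i ^ D.m i))) : D.H →ₐ[k] E :=
  RingQuot.liftAlgHom k ⟨FreeAlgebra.lift k (Sum.elim γ ξ), by
    intro a b hab
    cases hab with
    | one => simp [fg]
    | mul a b => simp [fg]
    | comm h i => simpa [fg, fx] using hcomm h i
    | link i j hij => simpa [fg, fx] using hlink i j hij
    | power i => simpa [fg, fx] using hpow i⟩

section lift

variable {E : Type*} [Ring E] [Algebra k E] (γ : G →* E) (ξ : Fin n → E)
    (hcomm : ∀ h i, γ h * ξ i = (D.χ i h : k) • (ξ i * γ h))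
    (hlink : ∀ i j, i ≠ j → ξ i * ξ j
      = (D.q i j : k) • (ξ j * ξ i) + D.lamLink i j • (1 - γ (D.g i * D.g j)))
    (hpow : ∀ i, ξ i ^ D.m i = D.lam i • (1 - γ (D.g i ^ D.m i)))

theorem lift_grp (h : G) : D.lift γ ξ hcomm hlink hpow (D.grp h) = γ h :=
  (RingQuot.liftAlgHom_mkAlgHom_apply _ _ _ _).trans (by simp [fg])

theorem lift_x (i : Fin n) : D.lift γ ξ hcomm hlink hpow (D.x i) = ξ i :=
  (RingQuot.liftAlgHom_mkAlgHom_apply _ _ _ _).trans (by simp [fx])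

end lift

theorem algHom_ext {E : Type*} [Ring E] [Algebra k E] {f f' : D.H →ₐ[k] E}
    (hg : ∀ h, f (D.grp h) = f' (D.grp h)) (hx : ∀ i, f (D.x i) = f' (D.x i)) : f = f' := by
  apply RingQuot.ringQuot_ext' k
  apply FreeAlgebra.hom_ext
  funext s
  cases s with
  | inl h => exact hg h
  | inr i => exact hx i

theorem m_pos [Finite G] (i : Fin n) : 0 < D.m i := by
  have h : IsOfFinOrder (D.q i i) := (D.χ i).isOfFinOrder (isOfFinOrder_of_finite (D.g i))
  exact h.orderOf_pos

/-- The group homomorphism `g ↦ g ⊗ g`. -/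
noncomputable def comulGrp : G →* D.H ⊗[k] D.H where
  toFun h := D.grp h ⊗ₜ[k] D.grp h
  map_one' := by simp [Algebra.TensorProduct.one_def]
  map_mul' a b := by simp

theorem comulGrp_apply (h : G) : D.comulGrp h = D.grp h ⊗ₜ[k] D.grp h := rfl

section bialgebra

variable [Finite G]

/-- The comultiplication, `g ↦ g ⊗ g` and `x_i ↦ g_i ⊗ x_i + x_i ⊗ 1`. -/
noncomputable def comulHom : D.H →ₐ[k] D.H ⊗[k] D.H :=
  D.lift D.comulGrp
    (fun i => D.grp (D.g i) ⊗ₜ[k] D.x i + D.x i ⊗ₜ[k] 1)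
    (by
      intro h i
      simp only [comulGrp_apply, mul_add, add_mul,
        Algebra.TensorProduct.tmul_mul_tmul, grp_mul_x, ← map_mul, mul_comm h, smul_add,
        TensorProduct.tmul_smul, TensorProduct.smul_tmul', mul_one, one_mul])
    (by
      intro i j hij
      have hq : (D.q i j : k) * (D.q j i : k) = 1 := by
        rw [← Units.val_mul, q, q, mul_comm, D.χ_mul_χ i j hij]; rfl
      have e1 : D.grp (D.g i) * D.x j = (D.q i j : k) • (D.x j * D.grp (D.g i)) := D.grp_mul_x _ _
      have e2 : D.grp (D.g j) * D.x i = (D.q j i : k) • (D.x i * D.grp (D.g j)) := D.grp_mul_x _ _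
      simp only [comulGrp_apply, mul_add, add_mul,
        Algebra.TensorProduct.tmul_mul_tmul, mul_one, one_mul, e1, e2, D.x_mul_x hij,
        ← map_mul, mul_comm (D.g j) (D.g i), smul_add, smul_sub,
        TensorProduct.tmul_add, TensorProduct.add_tmul, TensorProduct.tmul_sub,
        TensorProduct.sub_tmul, TensorProduct.tmul_smul, ← TensorProduct.smul_tmul', smul_smul, hq,
        one_smul, Algebra.TensorProduct.one_def]
      abel)
    (by
      intro i
      have h : (D.grp (D.g i) ⊗ₜ[k] D.x i) * (D.x i ⊗ₜ[k] (1 : D.H))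
          = (D.q i i : k) • ((D.x i ⊗ₜ[k] (1 : D.H)) * (D.grp (D.g i) ⊗ₜ[k] D.x i)) := by
        rw [Algebra.TensorProduct.tmul_mul_tmul, Algebra.TensorProduct.tmul_mul_tmul,
          D.grp_mul_x, one_mul, mul_one, TensorProduct.smul_tmul']
        rfl
      rw [add_comm, m, qcomm_add_pow_orderOf h (D.m_pos i), ← m]
      simp only [Algebra.TensorProduct.tmul_pow, x_pow, one_pow, ← map_pow, comulGrp_apply, TensorProduct.tmul_smul, ← TensorProduct.smul_tmul', ← smul_add,
        TensorProduct.tmul_sub, TensorProduct.sub_tmul, Algebra.TensorProduct.one_def]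
      congr 1
      abel)

@[simp] theorem comulHom_grp (h : G) : D.comulHom (D.grp h) = D.grp h ⊗ₜ[k] D.grp h :=
  D.lift_grp _ _ _ _ _ h

@[simp] theorem comulHom_x (i : Fin n) :
    D.comulHom (D.x i) = D.grp (D.g i) ⊗ₜ[k] D.x i + D.x i ⊗ₜ[k] 1 :=
  D.lift_x _ _ _ _ _ i

/-- The counit, `g ↦ 1` and `x_i ↦ 0`. -/
noncomputable def counitHom : D.H →ₐ[k] k :=
  D.lift 1 (fun _ => 0) (by simp) (by simp) (by
    intro i
    simp [(D.m_pos i).ne'])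

@[simp] theorem counitHom_grp (h : G) : D.counitHom (D.grp h) = 1 :=
  D.lift_grp _ _ _ _ _ h

@[simp] theorem counitHom_x (i : Fin n) : D.counitHom (D.x i) = 0 :=
  D.lift_x _ _ _ _ _ i

/-- The bialgebra structure of `H(𝐠, χ, λ)`. -/
noncomputable instance : Bialgebra k D.H :=
  Bialgebra.ofAlgHom D.comulHom D.counitHom
    (D.algHom_ext (by simp) (by
      intro i
      simp [TensorProduct.tmul_add, TensorProduct.add_tmul, Algebra.TensorProduct.one_def,
        add_assoc]))
    (D.algHom_ext (by simp) (by simp))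
    (D.algHom_ext (by simp) (by simp))

end bialgebra

/-- The element `(x_1 g_1⁻¹)^{r_1} ⋯ (x_n g_n⁻¹)^{r_n} h` of `H`, in this order.  The exponent
`r_i ∈ ℤ / m_i` is represented by the natural number `(r i).val` with `0 ≤ (r i).val < m_i`. -/
noncomputable def monomial (r : ∀ i, ZMod (D.m i)) (h : G) : D.H :=
  (List.ofFn fun i => (D.x i * D.grp (D.g i)⁻¹) ^ (r i).val).prod * D.grp h

/-- The subgroup `L₁ = ⟨q_11, …, q_nn, α(G)⟩` of `kˣ`, for a linear form `α` on `H`. -/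
def L₁ (α : Module.Dual k D.H) : Subgroup kˣ :=
  Subgroup.closure
    ((Set.range fun i => D.q i i) ∪ {u : kˣ | ∃ h : G, (u : k) = α (D.grp h)})

/-- The component `H_ω = {h ∈ H : ρ(h) = ω h}`. -/
noncomputable def component (ρ : D.H ≃ₐ[k] D.H) (ω : k) : Submodule k D.H :=
  Module.End.eigenspace (ρ : D.H →ₗ[k] D.H) ω

end LiftingDatum

/-!
A right integral in `H*` is built by adjoining the generators one at a time. With `y_i = x_i g_i⁻¹`
and `H'` the lifting without the first generator, `H = ⨁ y_0 ^ s H'` for `0 ≤ s < m_0`, where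
independence comes from a faithful action of `H` on `m_0` copies of `H'`: `x_0` acts as a shift
corrected by a skew derivation of `H'`. An integral of `H'`, read off the summand
`y_0 ^ (m_0 - 1) H'`, is an integral of `H` up to a group-like factor.

Everything else uses only that `β(a ⊗ b) = Δ(a)(1 ⊗ b)` is surjective, which is visible on the
generators. It makes every nonzero right integral `φ` a Frobenius homomorphism, and right integrals
unique up to a scalar. For `u` group-like, `z ↦ φ(u z u⁻¹)` is again a right integral, hence a
multiple of `φ`; evaluation at a right integral of `H` identifies the factor as `α(u)`. Likewise
`z ↦ φ(x_i z) - q_ii α(g_i) φ(z x_i)` is a right integral, and it vanishes. So `ρ` scales `g` by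
`α(g)⁻¹` and `y_i` by `q_ii⁻¹`.
-/

section Frobenius

variable {k A : Type*} [Field k] [Ring A] [Algebra k A] [Module.Finite k A]
  {φ : Module.Dual k A}

theorem isFrobeniusHom_iff_isPerfPair :
    IsFrobeniusHom φ ↔ ((LinearMap.mul k A).compr₂ φ).IsPerfPair := by
  refine ⟨fun hφ => ?_, fun hφ => hφ.bijective_right⟩
  rw [← LinearMap.flip_flip ((LinearMap.mul k A).compr₂ φ)]
  exact (LinearMap.IsPerfPair.of_bijective ((LinearMap.mul k A).compr₂ φ).flip hφ).flip

theorem isFrobeniusHom_of_separatingLeft (h : ∀ x, (∀ y, φ (x * y) = 0) → x = 0) :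
    IsFrobeniusHom φ := by
  have hinj : Function.Injective ((LinearMap.mul k A).compr₂ φ) :=
    (injective_iff_map_eq_zero _).mpr fun x hx => h x (LinearMap.congr_fun hx)
  exact isFrobeniusHom_iff_isPerfPair.mpr <| .of_bijective _ ⟨hinj,
    (LinearMap.injective_iff_surjective_of_finrank_eq_finrank
      Subspace.dual_finrank_eq.symm).mp hinj⟩

namespace IsFrobeniusHom

theorem eq_of_forall_mul_eq (hφ : IsFrobeniusHom φ) {x x' : A}
    (h : ∀ y, φ (x * y) = φ (x' * y)) : x = x' :=
  (isFrobeniusHom_iff_isPerfPair.mp hφ).bijective_left.injective (LinearMap.ext h)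

theorem exists_forall_mul_eq (hφ : IsFrobeniusHom φ) (f : Module.Dual k A) :
    ∃ x, ∀ y, φ (x * y) = f y :=
  let ⟨x, hx⟩ := (isFrobeniusHom_iff_isPerfPair.mp hφ).bijective_left.surjective f
  ⟨x, LinearMap.congr_fun hx⟩

theorem existsUnique_isNakayamaAut (hφ : IsFrobeniusHom φ) :
    ∃! ρ : A ≃ₐ[k] A, IsNakayamaAut φ ρ := by
  choose r hr using fun x => hφ.exists_forall_mul_eq (φ ∘ₗ LinearMap.mulRight k x)
  simp only [LinearMap.comp_apply, LinearMap.mulRight_apply] at hr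
  let R : A →ₐ[k] A :=
    { toFun := r
      map_one' := hφ.eq_of_forall_mul_eq fun y => by simp [hr]
      map_mul' := fun a b => hφ.eq_of_forall_mul_eq fun y => by
        rw [hr, mul_assoc, hr a, mul_assoc, hr b, mul_assoc]
      map_zero' := hφ.eq_of_forall_mul_eq fun y => by simp [hr]
      map_add' := fun a b => hφ.eq_of_forall_mul_eq fun y => by simp [hr, add_mul, mul_add]
      commutes' := fun c => hφ.eq_of_forall_mul_eq fun y => by rw [hr, Algebra.commutes] }
  have hR : Function.Injective R.toLinearMap := fun a b (hab : r a = r b) => hφ.1 <| by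
    ext y
    simp only [LinearMap.comp_apply, LinearMap.mulRight_apply]
    rw [← hr a, hab, hr b]
  refine ⟨AlgEquiv.ofBijective R ⟨hR, LinearMap.injective_iff_surjective.mp hR⟩,
    fun x y => (hr x y).symm, fun ρ hρ => ?_⟩
  ext x
  exact hφ.eq_of_forall_mul_eq fun y => (hρ x y).symm.trans (hr x y).symm

end IsFrobeniusHom

end Frobenius

section contract

variable {k V V' W W' : Type*} [Field k] [AddCommGroup V] [Module k V] [AddCommGroup V']
  [Module k V'] [AddCommGroup W] [Module k W] [AddCommGroup W'] [Module k W']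

/-- Contraction of the first tensor factor with a linear form, `v ⊗ w ↦ f(v) w`. -/
noncomputable def contract (f : Module.Dual k V) : V ⊗[k] W →ₗ[k] W :=
  (TensorProduct.lid k W).toLinearMap ∘ₗ f.rTensor W

@[simp] theorem contract_tmul (f : Module.Dual k V) (v : V) (w : W) :
    contract f (v ⊗ₜ[k] w) = f v • w := by
  simp [contract]

theorem contract_sub (f f' : Module.Dual k V) (t : V ⊗[k] W) :
    contract (f - f') t = contract f t - contract f' t := by
  simp [contract, LinearMap.rTensor_sub]

theorem contract_smul (c : k) (f : Module.Dual k V) (t : V ⊗[k] W) :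
    contract (c • f) t = c • contract f t := by
  simp [contract, LinearMap.rTensor_smul]

theorem contract_rTensor (f : Module.Dual k V) (g : V' →ₗ[k] V) (t : V' ⊗[k] W) :
    contract f (g.rTensor W t) = contract (f ∘ₗ g) t := by
  rw [contract, contract, LinearMap.rTensor_comp]
  rfl

theorem contract_map (f : Module.Dual k V) (g : V' →ₗ[k] V) (g' : W →ₗ[k] W') (t : V' ⊗[k] W) :
    contract f (TensorProduct.map g g' t) = g' (contract (f ∘ₗ g) t) := by
  induction t with
  | zero => simp
  | add t t' h h' => simp only [map_add, h, h']
  | tmul v w => simp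

theorem mul'_map_eq_apply_contract (f f' : Module.Dual k V) (t : V ⊗[k] V) :
    LinearMap.mul' k k (TensorProduct.map f f' t) = f' (contract f t) := by
  induction t with
  | zero => simp
  | add t t' h h' => simp only [map_add, h, h']
  | tmul v w => simp

theorem mem_range_rTensor_subtype_of_contract_eq_zero {ι : Type*} {f : ι → Module.Dual k V}
    {N : Submodule k V} (hN : ∀ v, (∀ i, f i v = 0) → v ∈ N) {t : V ⊗[k] W}
    (ht : ∀ i, contract (f i) t = 0) : t ∈ LinearMap.range (N.subtype.rTensor W) := by
  classical
  let c := Module.Basis.ofVectorSpace k W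
  have hcoeff (j) : TensorProduct.equivFinsuppOfBasisRight c t j ∈ N := by
    refine hN _ fun i => ?_
    have hswap (s : V ⊗[k] W) : f i (TensorProduct.rid k V ((c.coord j).lTensor V s))
        = c.coord j (contract (f i) s) := by
      induction s with
      | zero => simp
      | add s s' h h' => simp only [map_add, h, h']
      | tmul v w => simp [mul_comm]
    rw [TensorProduct.equivFinsuppOfBasisRight_apply, hswap, ht, map_zero]
  rw [← (TensorProduct.equivFinsuppOfBasisRight c).symm_apply_apply t,
    TensorProduct.equivFinsuppOfBasisRight_symm_apply]
  exact Submodule.sum_mem _ fun j _ => ⟨⟨_, hcoeff j⟩ ⊗ₜ c j, by simp⟩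

theorem eq_of_contract_eq {t t' : V ⊗[k] W}
    (h : ∀ f : Module.Dual k V, contract f t = contract f t') : t = t' := by
  classical
  let b := Module.Basis.ofVectorSpace k V
  refine (TensorProduct.equivFinsuppOfBasisLeft b).injective (Finsupp.ext fun i => ?_)
  rw [TensorProduct.equivFinsuppOfBasisLeft_apply, TensorProduct.equivFinsuppOfBasisLeft_apply]
  exact h (b.coord i)

end contract

section contractAlgebra

variable {k A B : Type*} [Field k] [Ring A] [Algebra k A] [Ring B] [Algebra k B]

theorem contract_tmul_mul (f : Module.Dual k A) (a : A) (b : B) (t : A ⊗[k] B) :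
    contract f ((a ⊗ₜ[k] b) * t) = b * contract (f ∘ₗ LinearMap.mulLeft k a) t := by
  induction t with
  | zero => simp
  | add t t' h h' => rw [mul_add, map_add, h, h', map_add, mul_add]
  | tmul c d => simp

theorem contract_mul_tmul (f : Module.Dual k A) (a : A) (b : B) (t : A ⊗[k] B) :
    contract f (t * (a ⊗ₜ[k] b)) = contract (f ∘ₗ LinearMap.mulRight k a) t * b := by
  induction t with
  | zero => simp
  | add t t' h h' => rw [add_mul, map_add, h, h', map_add, add_mul]
  | tmul c d => simp

end contractAlgebra

section galoisMap

variable {k A : Type*} [Field k] [Ring A] [Bialgebra k A]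

variable (k A) in
/-- The Galois map `a ⊗ b ↦ Δ(a)(1 ⊗ b)` of a bialgebra. It is bijective if and only if the
bialgebra has an antipode, and its surjectivity is how this file uses the antipode. -/
noncomputable def galoisMap : A ⊗[k] A →ₗ[k] A ⊗[k] A :=
  TensorProduct.lift <| (LinearMap.mul k (A ⊗[k] A)).compl₁₂ Coalgebra.comul
    (Algebra.TensorProduct.includeRight : A →ₐ[k] A ⊗[k] A).toLinearMap

@[simp] theorem galoisMap_tmul (a b : A) :
    galoisMap k A (a ⊗ₜ[k] b) = Coalgebra.comul a * (1 ⊗ₜ[k] b) := by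
  simp [galoisMap]

theorem galoisMap_mul_one_tmul (t : A ⊗[k] A) (b : A) :
    galoisMap k A (t * (1 ⊗ₜ[k] b)) = galoisMap k A t * (1 ⊗ₜ[k] b) := by
  induction t with
  | zero => simp
  | add t t' h h' => simp only [add_mul, map_add, h, h']
  | tmul a c => simp [mul_assoc]

theorem galoisMap_tmul_one_mul (a : A) (t : A ⊗[k] A) :
    galoisMap k A ((a ⊗ₜ[k] 1) * t) = Coalgebra.comul a * galoisMap k A t := by
  induction t with
  | zero => simp
  | add t t' h h' => simp only [mul_add, map_add, h, h']
  | tmul b c => simp [mul_assoc]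

theorem contract_counit_comul (a : A) :
    contract Coalgebra.counit (Coalgebra.comul (R := k) a) = a := by
  simp [contract]

theorem contract_counit_galoisMap (t : A ⊗[k] A) :
    contract Coalgebra.counit (galoisMap k A t) = LinearMap.mul' k A t := by
  induction t with
  | zero => simp
  | add t t' h h' => simp only [map_add, h, h']
  | tmul a b =>
    rw [galoisMap_tmul, contract_mul_tmul, LinearMap.mulRight_one, LinearMap.comp_id,
      contract_counit_comul, LinearMap.mul'_apply]

theorem mul_tmul_one_mem_range_galoisMap {a b : A}
    (ha : a ⊗ₜ[k] 1 ∈ LinearMap.range (galoisMap k A))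
    (hb : b ⊗ₜ[k] 1 ∈ LinearMap.range (galoisMap k A)) :
    (a * b) ⊗ₜ[k] 1 ∈ LinearMap.range (galoisMap k A) := by
  obtain ⟨t, ht⟩ := ha
  obtain ⟨u, hu⟩ := hb
  have hmem (s : A ⊗[k] A) :
      galoisMap k A s * (b ⊗ₜ[k] 1) ∈ LinearMap.range (galoisMap k A) := by
    induction s with
    | zero => simp
    | add s s' h h' => simpa only [map_add, add_mul] using add_mem h h'
    | tmul c d =>
      refine ⟨(c ⊗ₜ 1) * u * (1 ⊗ₜ d), ?_⟩
      rw [galoisMap_mul_one_tmul, galoisMap_tmul_one_mul, hu, galoisMap_tmul, mul_assoc, mul_assoc]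
      simp
  simpa [ht] using hmem t

theorem galoisMap_surjective_of_adjoin_eq_top {s : Set A} (hs : Algebra.adjoin k s = ⊤)
    (h : ∀ a ∈ s, a ⊗ₜ[k] 1 ∈ LinearMap.range (galoisMap k A)) :
    Function.Surjective (galoisMap k A) := by
  have hA (a : A) : a ⊗ₜ[k] 1 ∈ LinearMap.range (galoisMap k A) := by
    have ha : a ∈ Algebra.adjoin k s := hs ▸ trivial
    induction ha using Algebra.adjoin_induction with
    | mem a ha => exact h a ha
    | algebraMap c => exact ⟨algebraMap k A c ⊗ₜ 1, by simp⟩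
    | add a b _ _ ha hb => simpa only [TensorProduct.add_tmul] using add_mem ha hb
    | mul a b _ _ ha hb => exact mul_tmul_one_mem_range_galoisMap ha hb
  refine LinearMap.range_eq_top.mp (eq_top_iff.mpr fun t _ => ?_)
  induction t with
  | zero => exact zero_mem _
  | add t t' h h' => exact add_mem (h trivial) (h' trivial)
  | tmul a b =>
    obtain ⟨t, ht⟩ := hA a
    exact ⟨t * (1 ⊗ₜ b), by simp [galoisMap_mul_one_tmul, ht]⟩

theorem tmul_one_mem_range_galoisMap_of_isGroupLikeElem {u : Aˣ}
    (hu : IsGroupLikeElem k (u : A)) :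
    (u : A) ⊗ₜ[k] 1 ∈ LinearMap.range (galoisMap k A) :=
  ⟨(u : A) ⊗ₜ ((u⁻¹ : Aˣ) : A), by simp [hu.comul_eq_tmul_self]⟩

theorem tmul_one_mem_range_galoisMap_of_comul_eq {u : Aˣ} {x : A}
    (hu : IsGroupLikeElem k (u : A))
    (hx : Coalgebra.comul x = (u : A) ⊗ₜ[k] x + x ⊗ₜ[k] 1) :
    x ⊗ₜ[k] 1 ∈ LinearMap.range (galoisMap k A) :=
  ⟨x ⊗ₜ 1 - (u : A) ⊗ₜ (((u⁻¹ : Aˣ) : A) * x), by simp [hx, hu.comul_eq_tmul_self, add_mul]⟩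

end galoisMap

section rightCoideal

variable {k A : Type*} [Field k] [Ring A] [Bialgebra k A] [Module.Finite k A]

theorem eq_bot_of_comul_mem_range_rTensor_subtype
    (hβ : Function.Surjective (galoisMap k A)) {N : Submodule k A}
    (hmul : ∀ x ∈ N, ∀ z, x * z ∈ N)
    (hcomul : ∀ x ∈ N, Coalgebra.comul x ∈ LinearMap.range (N.subtype.rTensor A))
    (hone : (1 : A) ∉ N) : N = ⊥ := by
  set M := LinearMap.range (N.subtype.rTensor A)
  have hMmul (a : A) {t} (ht : t ∈ M) : t * (1 ⊗ₜ a) ∈ M := by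
    obtain ⟨s, rfl⟩ := ht
    refine ⟨(LinearMap.mulRight k a).lTensor N s, ?_⟩
    induction s with
    | zero => simp
    | add s s' h h' => simp only [map_add, add_mul, h, h']
    | tmul x b => simp
  have hβM : ∀ t ∈ M, galoisMap k A t ∈ M := by
    rintro _ ⟨s, rfl⟩
    induction s with
    | zero => simp
    | add s s' h h' => simpa only [map_add] using add_mem h h'
    | tmul x a => simpa using hMmul a (hcomul x x.2)
  have hβM_surj : Function.Surjective ((galoisMap k A).restrict hβM) :=
    LinearMap.injective_iff_surjective.mp fun t t' h => Subtype.ext <|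
      LinearMap.injective_iff_surjective.mpr hβ (congrArg Subtype.val h)
  have hmul'_mem : ∀ t ∈ M, LinearMap.mul' k A t ∈ N := by
    rintro _ ⟨s, rfl⟩
    induction s with
    | zero => simp
    | add s s' h h' => simpa only [map_add] using add_mem h h'
    | tmul x a => simpa using hmul x x.2 a
  -- `x ⊗ 1 = β(t)` with `t ∈ M`, and applying `ε ⊗ id` yields `ε(x) 1 = mul' t ∈ N`.
  have hcounit : ∀ x ∈ N, Coalgebra.counit (R := k) x = 0 := by
    intro x hx
    obtain ⟨⟨t, ht⟩, hβt⟩ := hβM_surj ⟨x ⊗ₜ 1, ⟨⟨x, hx⟩ ⊗ₜ 1, by simp⟩⟩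
    have hmem := hmul'_mem t ht
    rw [← contract_counit_galoisMap, show galoisMap k A t = x ⊗ₜ 1 from congrArg Subtype.val hβt,
      contract_tmul] at hmem
    by_contra h
    exact hone ((N.smul_mem_iff h).mp hmem)
  refine N.eq_bot_iff.mpr fun x hx => ?_
  obtain ⟨s, hs⟩ := hcomul x hx
  have hcounitN : Coalgebra.counit (R := k) ∘ₗ N.subtype = 0 :=
    LinearMap.ext fun x => hcounit x x.2
  rw [← contract_counit_comul (k := k) x, ← hs, contract_rTensor, hcounitN]
  simp [contract]

end rightCoideal

section twistedIntegral

variable {k A : Type*} [Field k] [Ring A] [Bialgebra k A]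

/-- `f` is a right integral in the dual algebra twisted by `γ`: `f(a₁) a₂ = f(a) γ` for all `a`.
For `γ = 1` these are the right integrals; multiplying by group-likes changes `γ`. -/
def IsTwistedIntegralDual (γ : A) (f : Module.Dual k A) : Prop :=
  ∀ a, contract f (Coalgebra.comul a) = f a • γ

theorem isTwistedIntegralDual_one_iff {φ : Module.Dual k A} :
    IsTwistedIntegralDual 1 φ ↔ IsRightIntegralDual φ := by
  have happly (f : Module.Dual k A) (a : A) :
      (LinearMap.mul' k k ∘ₗ TensorProduct.map φ f ∘ₗ Coalgebra.comul) a
        = f (contract φ (Coalgebra.comul a)) := mul'_map_eq_apply_contract φ f _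
  refine ⟨fun hφ f => LinearMap.ext fun a => ?_, fun hφ a => ?_⟩
  · rw [happly, hφ, map_smul, LinearMap.smul_apply, smul_eq_mul, smul_eq_mul, mul_comm]
  · rw [← sub_eq_zero, ← Module.forall_dual_apply_eq_zero_iff k]
    intro f
    rw [map_sub, ← happly, hφ f, map_smul, LinearMap.smul_apply, smul_eq_mul, smul_eq_mul,
      mul_comm, sub_self]

theorem isTwistedIntegralDual_of_basis {ι : Type*} (b : Module.Basis ι k A) {γ : A}
    {f : Module.Dual k A} (h : ∀ i, contract f (Coalgebra.comul (b i)) = f (b i) • γ) :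
    IsTwistedIntegralDual γ f :=
  LinearMap.congr_fun (f := contract f ∘ₗ Coalgebra.comul)
    (g := LinearMap.toSpanSingleton k A γ ∘ₗ f) (b.ext h)

namespace IsTwistedIntegralDual

variable {γ : A} {f : Module.Dual k A} {u : Aˣ}

theorem comp_mulLeft (hf : IsTwistedIntegralDual γ f) (hu : IsGroupLikeElem k (u : A)) :
    IsTwistedIntegralDual (((u⁻¹ : Aˣ) : A) * γ) (f ∘ₗ LinearMap.mulLeft k (u : A)) := by
  intro a
  have h := hf ((u : A) * a)
  rw [Bialgebra.comul_mul, hu.comul_eq_tmul_self, contract_tmul_mul] at h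
  rw [LinearMap.comp_apply, LinearMap.mulLeft_apply, ← mul_smul_comm, ← h, u.inv_mul_cancel_left]

theorem comp_mulRight (hf : IsTwistedIntegralDual γ f) (hu : IsGroupLikeElem k (u : A)) :
    IsTwistedIntegralDual (γ * ((u⁻¹ : Aˣ) : A)) (f ∘ₗ LinearMap.mulRight k (u : A)) := by
  intro a
  have h := hf (a * (u : A))
  rw [Bialgebra.comul_mul, hu.comul_eq_tmul_self, contract_mul_tmul] at h
  rw [LinearMap.comp_apply, LinearMap.mulRight_apply, ← smul_mul_assoc, ← h,
    u.mul_inv_cancel_right]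

theorem exists_isRightIntegralDual (hf : IsTwistedIntegralDual (u : A) f) (hf0 : f ≠ 0)
    (hu : IsGroupLikeElem k (u : A)) : ∃ φ : Module.Dual k A, φ ≠ 0 ∧ IsRightIntegralDual φ := by
  refine ⟨f ∘ₗ LinearMap.mulLeft k (u : A), fun h => hf0 (LinearMap.ext fun a => ?_),
    isTwistedIntegralDual_one_iff.mp (u.inv_mul ▸ hf.comp_mulLeft hu)⟩
  simpa using LinearMap.congr_fun h (((u⁻¹ : Aˣ) : A) * a)

end IsTwistedIntegralDual

end twistedIntegral

namespace IsRightIntegralDual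

variable {k A : Type*} [Field k] [Ring A] [Bialgebra k A] {φ ψ : Module.Dual k A}

theorem contract_comul (hφ : IsRightIntegralDual φ) (a : A) :
    contract φ (Coalgebra.comul a) = φ a • (1 : A) :=
  isTwistedIntegralDual_one_iff.mpr hφ a

theorem contract_comul_mul_galoisMap (hφ : IsRightIntegralDual φ) (a : A) (t : A ⊗[k] A) :
    contract φ (Coalgebra.comul a * galoisMap k A t) = contract (φ ∘ₗ LinearMap.mulLeft k a) t := by
  induction t with
  | zero => simp
  | add t t' h h' => simp only [map_add, mul_add, h, h']
  | tmul b c =>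
    rw [galoisMap_tmul, ← mul_assoc, ← Bialgebra.comul_mul, contract_mul_tmul,
      LinearMap.mulRight_one, LinearMap.comp_id, hφ.contract_comul, contract_tmul, smul_one_mul,
      LinearMap.comp_apply, LinearMap.mulLeft_apply]

theorem sub_comp_skewPrimitive (hφ : IsRightIntegralDual φ) {u : Aˣ} {x : A} {q c : k}
    (hu : IsGroupLikeElem k (u : A))
    (hx : Coalgebra.comul x = (u : A) ⊗ₜ[k] x + x ⊗ₜ[k] 1)
    (hux : (u : A) * x = q • (x * (u : A))) (hc : ∀ a, φ ((u : A) * a) = c * φ (a * (u : A))) :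
    IsRightIntegralDual (φ ∘ₗ LinearMap.mulLeft k x - (q * c) • φ ∘ₗ LinearMap.mulRight k x) := by
  have hφ1 := isTwistedIntegralDual_one_iff.mpr hφ
  have hleft (a : A) : contract (φ ∘ₗ LinearMap.mulLeft k x) (Coalgebra.comul a)
      = φ (x * a) • 1 - φ ((u : A) * a) • (x * ((u⁻¹ : Aˣ) : A)) := by
    rw [← hφ.contract_comul, Bialgebra.comul_mul, hx, add_mul, map_add, contract_tmul_mul,
      contract_tmul_mul, hφ1.comp_mulLeft hu]
    simp
  have hright (a : A) : contract (φ ∘ₗ LinearMap.mulRight k x) (Coalgebra.comul a)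
      = φ (a * x) • 1 - φ (a * (u : A)) • (((u⁻¹ : Aˣ) : A) * x) := by
    rw [← hφ.contract_comul, Bialgebra.comul_mul, hx, mul_add, map_add, contract_mul_tmul,
      contract_mul_tmul, hφ1.comp_mulRight hu]
    simp
  have hcomm : x * ((u⁻¹ : Aˣ) : A) = q • (((u⁻¹ : Aˣ) : A) * x) := by
    rw [← u.inv_mul_cancel_left (x * _), ← mul_assoc (u : A), hux, smul_mul_assoc,
      u.mul_inv_cancel_right, mul_smul_comm]
  refine isTwistedIntegralDual_one_iff.mp fun a => ?_
  rw [contract_sub, contract_smul, hleft, hright, hc, hcomm]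
  simp only [LinearMap.sub_apply, LinearMap.smul_apply, LinearMap.comp_apply,
    LinearMap.mulLeft_apply, LinearMap.mulRight_apply, smul_eq_mul]
  module

variable [Module.Finite k A]

/-- The key point is that the radical `{x | φ(xA) = 0}` is a right ideal and a right coideal:
writing `z ⊗ 1 = β(t)` yields `φ(x₁z) x₂ = (φ(x ·) ⊗ id)(t) = 0` for `x` in the radical. -/
theorem isFrobeniusHom (hφ : IsRightIntegralDual φ) (hφ0 : φ ≠ 0)
    (hβ : Function.Surjective (galoisMap k A)) : IsFrobeniusHom φ := by
  set N := LinearMap.ker ((LinearMap.mul k A).compr₂ φ)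
  have hN (x : A) : x ∈ N ↔ ∀ z, φ (x * z) = 0 := LinearMap.mem_ker.trans LinearMap.ext_iff
  have hNmul : ∀ x ∈ N, ∀ z, x * z ∈ N := fun x hx z => (hN _).mpr fun w => by
    rw [mul_assoc, (hN x).mp hx]
  have hNcomul : ∀ x ∈ N, Coalgebra.comul x ∈ LinearMap.range (N.subtype.rTensor A) := by
    refine fun x hx => mem_range_rTensor_subtype_of_contract_eq_zero
      (f := fun z => φ ∘ₗ LinearMap.mulRight k z) (fun v hv => (hN v).mpr hv) fun z => ?_
    obtain ⟨t, ht⟩ := hβ (z ⊗ₜ 1)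
    rw [← mul_one (contract _ _), ← contract_mul_tmul, ← ht, hφ.contract_comul_mul_galoisMap,
      show φ ∘ₗ LinearMap.mulLeft k x = 0 from LinearMap.ext ((hN x).mp hx)]
    simp [contract]
  have hNone : (1 : A) ∉ N := fun h => hφ0 <| LinearMap.ext fun z => by
    simpa using (hN 1).mp h z
  refine isFrobeniusHom_of_separatingLeft fun x hx => ?_
  have hN_bot := eq_bot_of_comul_mem_range_rTensor_subtype hβ hNmul hNcomul hNone
  exact (Submodule.mem_bot k).mp (hN_bot ▸ (hN x).mpr hx)

theorem exists_eq_smul (hφ : IsRightIntegralDual φ) (hφ0 : φ ≠ 0)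
    (hβ : Function.Surjective (galoisMap k A)) (hψ : IsRightIntegralDual ψ) :
    ∃ c : k, ψ = c • φ := by
  have hF := hφ.isFrobeniusHom hφ0 hβ
  obtain ⟨a, rfl⟩ := hF.2 ψ
  obtain ⟨t, ht⟩ := hβ (a ⊗ₜ 1)
  have ht_eq : t = a ⊗ₜ 1 := eq_of_contract_eq fun f => by
    obtain ⟨x, hx⟩ := hF.exists_forall_mul_eq f
    rw [← show φ ∘ₗ LinearMap.mulLeft k x = f from LinearMap.ext hx,
      ← hφ.contract_comul_mul_galoisMap, ht, contract_mul_tmul, mul_one, hψ.contract_comul]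
    simp
  have hcomul : Coalgebra.comul a = a ⊗ₜ[k] (1 : A) := by
    rw [← ht, ht_eq, galoisMap_tmul, ← Algebra.TensorProduct.one_def, mul_one]
  have ha : a = Coalgebra.counit (R := k) a • (1 : A) := by
    rw [← contract_tmul, ← hcomul, contract_counit_comul]
  refine ⟨Coalgebra.counit (R := k) a, LinearMap.ext fun z => ?_⟩
  dsimp only
  rw [LinearMap.comp_apply, LinearMap.mulRight_apply, LinearMap.smul_apply]
  conv_lhs => rw [ha, mul_smul_comm, mul_one, map_smul]

end IsRightIntegralDual

theorem counit_eq_zero_of_comul_eq {k A : Type*} [Field k] [Ring A] [Bialgebra k A] {g x : A}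
    (hg : Coalgebra.counit (R := k) g = 1)
    (hx : Coalgebra.comul x = g ⊗ₜ[k] x + x ⊗ₜ[k] 1) : Coalgebra.counit (R := k) x = 0 := by
  have hx1 : x = x + Coalgebra.counit (R := k) x • (1 : A) := by
    conv_lhs => rw [← contract_counit_comul (k := k) x, hx, map_add, contract_tmul,
      contract_tmul, hg, one_smul]
  simpa using congrArg (Coalgebra.counit (R := k)) hx1

section modular

variable {k A : Type*} [Field k] [Ring A] [Bialgebra k A] {φ α : Module.Dual k A}

namespace IsModularElement

theorem map_one (hα : IsModularElement α) : α 1 = 1 := by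
  obtain ⟨t, ht0, -, hα⟩ := hα
  exact smul_left_injective k ht0 (by simp [← hα])

theorem map_mul (hα : IsModularElement α) (a b : A) : α (a * b) = α a * α b := by
  obtain ⟨t, ht0, -, hα⟩ := hα
  refine smul_left_injective k ht0 ?_
  simp only [← hα, mul_smul, mul_assoc]
  rw [hα b, mul_smul_comm, hα a, smul_comm]

end IsModularElement

namespace IsFrobeniusHom

variable [Module.Finite k A]

theorem exists_isModularElement (hφ : IsFrobeniusHom φ) :
    ∃ α : Module.Dual k A, IsModularElement α := by
  obtain ⟨t, ht⟩ := hφ.exists_forall_mul_eq Coalgebra.counit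
  have hint : IsRightIntegral (k := k) t := fun a => hφ.eq_of_forall_mul_eq fun y => by
    rw [mul_assoc, ht, Bialgebra.counit_mul, smul_mul_assoc, _root_.map_smul, ht, smul_eq_mul]
  refine ⟨φ ∘ₗ LinearMap.mulRight k t, t, ?_, hint, fun a => hφ.eq_of_forall_mul_eq fun y => ?_⟩
  · rintro rfl
    simpa using ht 1
  · rw [mul_assoc, hint, mul_smul_comm, _root_.map_smul, smul_mul_assoc, _root_.map_smul, ht]
    simp [mul_comm]

theorem apply_ne_zero_of_isRightIntegral (hφ : IsFrobeniusHom φ) {t : A} (ht0 : t ≠ 0)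
    (ht : IsRightIntegral (k := k) t) : φ t ≠ 0 := fun h =>
  ht0 <| hφ.eq_of_forall_mul_eq fun y => by simp [ht y, h]

end IsFrobeniusHom

namespace IsRightIntegralDual

variable [Module.Finite k A] {u : Aˣ}

theorem eq_smul_of_apply_eq (hφ : IsRightIntegralDual φ) (hφ0 : φ ≠ 0)
    (hβ : Function.Surjective (galoisMap k A)) {ψ : Module.Dual k A} (hψ : IsRightIntegralDual ψ)
    {t : A} (ht0 : t ≠ 0) (ht : IsRightIntegral (k := k) t) {c : k} (hc : ψ t = c * φ t) :
    ψ = c • φ := by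
  obtain ⟨d, rfl⟩ := hφ.exists_eq_smul hφ0 hβ hψ
  rw [mul_right_cancel₀ ((hφ.isFrobeniusHom hφ0 hβ).apply_ne_zero_of_isRightIntegral ht0 ht) hc]

theorem apply_unit_mul (hφ : IsRightIntegralDual φ) (hφ0 : φ ≠ 0)
    (hβ : Function.Surjective (galoisMap k A)) (hα : IsModularElement α)
    (hu : IsGroupLikeElem k (u : A)) (z : A) :
    φ ((u : A) * z) = α (u : A) * φ (z * (u : A)) := by
  obtain ⟨t, ht0, ht, hα⟩ := hα
  have hu' := hu.unitsInv
  have hψ := ((isTwistedIntegralDual_one_iff.mpr hφ).comp_mulLeft hu).comp_mulRight hu'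
  rw [mul_one, inv_inv, u.inv_mul, isTwistedIntegralDual_one_iff] at hψ
  have key := hφ.eq_smul_of_apply_eq hφ0 hβ hψ ht0 ht (c := α u) <| by
    simp [hα, ht ((u⁻¹ : Aˣ) : A), hu'.counit_eq_one]
  simpa using LinearMap.congr_fun key (z * u)

theorem apply_skewPrimitive_mul (hφ : IsRightIntegralDual φ) (hφ0 : φ ≠ 0)
    (hβ : Function.Surjective (galoisMap k A)) (hα : IsModularElement α)
    (hu : IsGroupLikeElem k (u : A)) {x : A} {q : k} (hq : q ≠ 1)
    (hx : Coalgebra.comul x = (u : A) ⊗ₜ[k] x + x ⊗ₜ[k] 1)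
    (hux : (u : A) * x = q • (x * (u : A))) (z : A) :
    φ (x * z) = q * α (u : A) * φ (z * x) := by
  have hψ := hφ.sub_comp_skewPrimitive hu hx hux (hφ.apply_unit_mul hφ0 hβ hα hu)
  have hεx := counit_eq_zero_of_comul_eq hu.counit_eq_one hx
  have hαx : α x = 0 := by
    have hαu : α (u : A) ≠ 0 := left_ne_zero_of_mul_eq_one <| by
      rw [← hα.map_mul, u.mul_inv, hα.map_one]
    have h := congrArg α hux
    rw [_root_.map_smul, hα.map_mul, hα.map_mul, smul_eq_mul] at h
    have hmul : (q - 1) * (α x * α (u : A)) = 0 := by linear_combination -h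
    exact (mul_eq_zero.mp ((mul_eq_zero.mp hmul).resolve_left (sub_ne_zero.mpr hq))).resolve_right
      hαu
  obtain ⟨t, ht0, ht, hαt⟩ := hα
  have hψ_eq := hφ.eq_smul_of_apply_eq hφ0 hβ hψ ht0 ht (c := 0) <| by
    simp [ht x, hαt, hεx, hαx]
  simpa [sub_eq_zero] using LinearMap.congr_fun hψ_eq z

end IsRightIntegralDual

end modular

section diagonal

variable {k ι V : Type*} [Field k] [AddCommGroup V] [Module k V]
  {b : Module.Basis ι k V} {μ : ι → k} {f : Module.End k V}

theorem mem_eigenspace_iff_of_basis (hf : ∀ i, f (b i) = μ i • b i) (z : k) (v : V) :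
    v ∈ Module.End.eigenspace f z ↔ ∀ i, b.repr v i ≠ 0 → μ i = z := by
  have hrepr (i : ι) : b.repr (f v) i = μ i * b.repr v i := by
    have : b.coord i ∘ₗ f = μ i • b.coord i := by
      classical
      refine b.ext fun j => ?_
      obtain rfl | hij := eq_or_ne j i <;> simp [*]
    exact LinearMap.congr_fun this v
  rw [Module.End.mem_eigenspace_iff]
  refine ⟨fun h i hi => ?_, fun h => b.repr.injective (Finsupp.ext fun i => ?_)⟩
  · refine mul_right_cancel₀ hi ?_
    rw [← hrepr, h, map_smul, Finsupp.smul_apply, smul_eq_mul]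
  · rw [hrepr, map_smul, Finsupp.smul_apply, smul_eq_mul]
    obtain hi | hi := eq_or_ne (b.repr v i) 0
    · rw [hi, mul_zero, mul_zero]
    · rw [h i hi]

theorem eigenspace_eq_span_of_basis (hf : ∀ i, f (b i) = μ i • b i) (z : k) :
    Module.End.eigenspace f z = Submodule.span k (b '' {i | μ i = z}) := by
  ext v
  rw [mem_eigenspace_iff_of_basis hf, b.mem_span_image]
  exact ⟨fun h i hi => h i (by simpa using hi), fun h i hi => h (by simpa using hi)⟩

theorem finrank_eigenspace_of_basis (hf : ∀ i, f (b i) = μ i • b i) (z : k) :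
    Module.finrank k (Module.End.eigenspace f z) = Nat.card {i // μ i = z} := by
  rw [eigenspace_eq_span_of_basis hf, ← Subtype.range_coe_subtype, ← Set.range_comp]
  exact Module.finrank_eq_nat_card_basis
    (Module.Basis.span (b.linearIndependent.comp _ Subtype.val_injective))

theorem eigenspace_ne_bot_iff_of_basis (hf : ∀ i, f (b i) = μ i • b i) (z : k) :
    Module.End.eigenspace f z ≠ ⊥ ↔ ∃ i, μ i = z := by
  refine ⟨fun h => ?_, ?_⟩
  · contrapose! h
    simp [eigenspace_eq_span_of_basis hf, h]
  · rintro ⟨i, rfl⟩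
    exact (Submodule.ne_bot_iff _).mpr
      ⟨b i, Module.End.mem_eigenspace_iff.mpr (hf i), b.ne_zero i⟩

theorem iSup_eigenspace_eq_top_of_basis (hf : ∀ i, f (b i) = μ i • b i) :
    ⨆ i, Module.End.eigenspace f (μ i) = ⊤ := by
  rw [eq_top_iff, ← b.span_eq, Submodule.span_le]
  rintro _ ⟨i, rfl⟩
  exact Submodule.mem_iSup_of_mem i (Module.End.mem_eigenspace_iff.mpr (hf i))

theorem finrank_eigenspace_of_character {K : Type*} [Group K] {b : Module.Basis K k V}
    {θ : K →* kˣ} (hf : ∀ κ, f (b κ) = (θ κ : k) • b κ) (κ : K) :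
    Module.finrank k (Module.End.eigenspace f (θ κ : k)) = Nat.card θ.ker := by
  rw [finrank_eigenspace_of_basis hf]
  refine Nat.card_congr ((Equiv.mulRight κ⁻¹).subtypeEquiv fun x => ?_)
  rw [Equiv.coe_mulRight, MonoidHom.mem_ker, map_mul, map_inv, mul_inv_eq_one, Units.val_inj]

end diagonal

section skewCommutation

variable {k E : Type*} [Field k] [Ring E] [Algebra k E]

theorem mul_eq_mul_of_adjoin_eq_top {A : Type*} [Ring A] [Algebra k A] {s : Set A}
    (hs : Algebra.adjoin k s = ⊤) {f g : A →ₐ[k] E} {t : E} (h : ∀ a ∈ s, t * f a = g a * t)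
    (a : A) : t * f a = g a * t := by
  have ha : a ∈ Algebra.adjoin k s := hs ▸ Algebra.mem_top
  induction ha using Algebra.adjoin_induction with
  | mem a ha => exact h a ha
  | algebraMap r => rw [AlgHom.commutes, AlgHom.commutes, Algebra.commutes]
  | add a b _ _ ha hb => rw [map_add, map_add, mul_add, add_mul, ha, hb]
  | mul a b _ _ ha hb => rw [map_mul, map_mul, ← mul_assoc, ha, mul_assoc, hb, mul_assoc]

theorem sum_smul_pow_mul_mul_pow_eq_zero {P d : E} {a b c : k} {r : ℕ}
    (h : P * d = c • (d * P)) (hr : a ^ r = (b * c) ^ r) (hne : a ≠ b * c) :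
    ∑ s ∈ Finset.range r, (a ^ s * b ^ (r - 1 - s)) • (P ^ (r - 1 - s) * d * P ^ s) = 0 := by
  have hP (s : ℕ) : P ^ s * d = c ^ s • (d * P ^ s) := by
    induction s with
    | zero => simp
    | succ s ih =>
      rw [pow_succ', mul_assoc, ih, mul_smul_comm, ← mul_assoc, h, smul_mul_assoc, smul_smul,
        mul_assoc, ← pow_succ', ← pow_succ]
  have hterm : ∀ s ∈ Finset.range r, (a ^ s * b ^ (r - 1 - s)) • (P ^ (r - 1 - s) * d * P ^ s)
      = (a ^ s * (b * c) ^ (r - 1 - s)) • (d * P ^ (r - 1)) := by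
    intro s hs
    rw [Finset.mem_range] at hs
    rw [hP, smul_mul_assoc, smul_smul, mul_assoc d, ← pow_add, mul_pow, mul_assoc,
      Nat.sub_add_cancel (by omega)]
  have hgeom : (∑ s ∈ Finset.range r, a ^ s * (b * c) ^ (r - 1 - s)) * (a - b * c) = 0 := by
    rw [(Commute.all _ _).geom_sum₂_mul, hr, sub_self]
  rw [Finset.sum_congr rfl hterm, ← Finset.sum_smul,
    (mul_eq_zero.mp hgeom).resolve_right (sub_ne_zero.mpr hne), zero_smul]

theorem sum_smul_pow_mul_one_sub_mul_pow_eq_zero {P e : E} {a b c : k} {r : ℕ}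
    (h : P * e = c • (e * P)) (hr : a ^ r = b ^ r) (hne : a ≠ b)
    (hr' : a ^ r = (b * c) ^ r) (hne' : a ≠ b * c) :
    ∑ s ∈ Finset.range r, (a ^ s * b ^ (r - 1 - s)) • (P ^ (r - 1 - s) * (1 - e) * P ^ s)
      = 0 := by
  have hone := sum_smul_pow_mul_mul_pow_eq_zero (P := P) (d := 1) (a := a) (b := b) (c := 1)
    (by simp) (by rwa [mul_one]) (by rwa [mul_one])
  simp only [mul_sub, sub_mul, smul_sub, Finset.sum_sub_distrib, hone, sub_zero,
    sum_smul_pow_mul_mul_pow_eq_zero h hr' hne']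

theorem pow_mul_of_mul_eq {P Y d : E} {q : k} (h : P * Y = q • (Y * P) + d) (r : ℕ) :
    P ^ r * Y = q ^ r • (Y * P ^ r)
      + ∑ s ∈ Finset.range r, q ^ s • (P ^ (r - 1 - s) * d * P ^ s) := by
  induction r with
  | zero => simp
  | succ r ih =>
    have hshift : ∀ s ∈ Finset.range r, q • (q ^ s • (P ^ (r - 1 - s) * d * P ^ s) * P)
        = q ^ (s + 1) • (P ^ (r + 1 - 1 - (s + 1)) * d * P ^ (s + 1)) := by
      intro s _
      rw [smul_mul_assoc, smul_smul, mul_assoc, ← pow_succ, ← pow_succ',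
        show r + 1 - 1 - (s + 1) = r - 1 - s by omega]
    rw [pow_succ, mul_assoc, h, mul_add, mul_smul_comm, ← mul_assoc, ih, add_mul, smul_add,
      Finset.sum_range_succ', Finset.sum_mul, Finset.smul_sum, Finset.sum_congr rfl hshift,
      smul_mul_assoc, smul_smul, mul_assoc, ← pow_succ, ← pow_succ', add_assoc]
    simp only [add_tsub_cancel_right, tsub_zero, pow_zero, one_smul, mul_one]

theorem upperTriangular_pow {R : Type*} [Ring R] (a d b : R) (r : ℕ) :
    !![a, d; 0, b] ^ r
      = !![a ^ r, ∑ s ∈ Finset.range r, a ^ (r - 1 - s) * d * b ^ s; 0, b ^ r] := by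
  induction r with
  | zero => simp [Matrix.one_fin_two]
  | succ r ih =>
    have hshift : ∀ s ∈ Finset.range r, a ^ (r - 1 - s) * d * b ^ s * b
        = a ^ (r + 1 - 1 - (s + 1)) * d * b ^ (s + 1) := by
      intro s _
      rw [mul_assoc, ← pow_succ, show r + 1 - 1 - (s + 1) = r - 1 - s by omega]
    rw [pow_succ, ih, Matrix.mul_fin_two, Finset.sum_range_succ', Finset.sum_mul (a := b),
      Finset.sum_congr rfl hshift]
    simp [pow_succ, add_comm]

end skewCommutation

theorem pow_apply_eq_smul {k A : Type*} [Field k] [Ring A] [Algebra k A] {σ : A →ₐ[k] A} {a : A}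
    {q : k} (h : σ a = q • a) (r : ℕ) : (σ ^ r) a = q ^ r • a := by
  induction r with
  | zero => simp
  | succ r ih => rw [pow_succ, AlgHom.mul_apply, h, map_smul, ih, smul_smul, pow_succ']

/-- `δ` is a left `σ`-derivation, for the algebra endomorphism `σ`. -/
def IsSkewDerivation {k A : Type*} [Field k] [Ring A] [Algebra k A] (σ : A →ₐ[k] A)
    (δ : A →ₗ[k] A) : Prop :=
  ∀ a b, δ (a * b) = σ a * δ b + δ a * b

theorem IsSkewDerivation.map_one {k A : Type*} [Field k] [Ring A] [Algebra k A] {σ : A →ₐ[k] A}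
    {δ : A →ₗ[k] A} (hδ : IsSkewDerivation σ δ) : δ 1 = 0 := by
  simpa using hδ 1 1

section skewBlock

variable {k A : Type*} [Field k] [Ring A] [Algebra k A] (σ : A →ₐ[k] A)

/-- The matrix `[[σ a, d], [0, a]]`. An algebra map `a ↦ skewBlock σ a (δ a)` is the same thing as
a left `σ`-derivation `δ`, so that derivations can be defined on generators. -/
def skewBlock (a d : A) : Matrix (Fin 2) (Fin 2) A := !![σ a, d; 0, a]

theorem skewBlock_one : skewBlock σ 1 0 = 1 := by
  rw [skewBlock, map_one, Matrix.one_fin_two]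

theorem skewBlock_add (a b d e : A) :
    skewBlock σ a d + skewBlock σ b e = skewBlock σ (a + b) (d + e) := by
  simp [skewBlock]

theorem skewBlock_sub (a b d e : A) :
    skewBlock σ a d - skewBlock σ b e = skewBlock σ (a - b) (d - e) := by
  simp [skewBlock]

theorem skewBlock_smul (c : k) (a d : A) :
    c • skewBlock σ a d = skewBlock σ (c • a) (c • d) := by
  simp [skewBlock]

theorem skewBlock_mul (a b d e : A) :
    skewBlock σ a d * skewBlock σ b e = skewBlock σ (a * b) (σ a * e + d * b) := by
  simp [skewBlock]

theorem skewBlock_pow (a d : A) (r : ℕ) : skewBlock σ a d ^ r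
    = skewBlock σ (a ^ r) (∑ s ∈ Finset.range r, σ a ^ (r - 1 - s) * d * a ^ s) := by
  rw [skewBlock, upperTriangular_pow, skewBlock, map_pow]

theorem isSkewDerivation_of_forall_eq_skewBlock {f : A →ₐ[k] Matrix (Fin 2) (Fin 2) A}
    (h : ∀ a, f a = skewBlock σ a (f a 0 1)) :
    IsSkewDerivation σ (Matrix.entryLinearMap k A 0 1 ∘ₗ f.toLinearMap) := fun a b => by
  have hmul := map_mul f a b
  rw [h a, h b, skewBlock_mul] at hmul
  exact congr_fun₂ hmul 0 1

end skewBlock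

section skewShift

variable {k A : Type*} [Field k] [Ring A] [Algebra k A] (σ : A →ₐ[k] A) (δ : A →ₗ[k] A) (c : A)
  (m : ℕ)

/-- Left multiplication by the variable `X` on the free left `A`-module with basis
`1, X, …, X ^ (m - 1)`, where `X a = σ(a) X + δ(a)` and `X ^ m = c`. -/
def skewShift : Module.End k (ZMod m → A) where
  toFun v r := δ (v r) + σ (v (r - 1)) * (if r = 0 then c else 1)
  map_add' v w := by
    funext r
    simp only [Pi.add_apply, map_add, add_mul]
    abel
  map_smul' t v := by
    funext r
    simp only [Pi.smul_apply, map_smul, smul_mul_assoc, smul_add, RingHom.id_apply]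

variable (k) in
/-- Right multiplication by the variable `X` on the same module. -/
def skewShiftRight : Module.End k (ZMod m → A) := skewShift (AlgHom.id k A) 0 c m

variable {σ δ c m}

theorem skewShift_apply (v : ZMod m → A) (r : ZMod m) :
    skewShift σ δ c m v r = δ (v r) + σ (v (r - 1)) * (if r = 0 then c else 1) := rfl

theorem skewShiftRight_apply (v : ZMod m → A) (r : ZMod m) :
    skewShiftRight k c m v r = v (r - 1) * (if r = 0 then c else 1) := zero_add _

theorem skewShift_mul_lsmul (hδ : IsSkewDerivation σ δ) (a : A) :
    skewShift σ δ c m * Algebra.lsmul k k (ZMod m → A) a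
      = Algebra.lsmul k k (ZMod m → A) (σ a) * skewShift σ δ c m
        + Algebra.lsmul k k (ZMod m → A) (δ a) := by
  ext1 v
  funext r
  simp only [Module.End.mul_apply, LinearMap.add_apply, Algebra.lsmul_coe, skewShift_apply,
    Pi.add_apply, Pi.smul_apply, smul_eq_mul, map_mul, hδ a, mul_add, mul_assoc]
  abel

theorem skewShift_pow_mul_lsmul (hδ : IsSkewDerivation σ δ) {a : A} {q : k} (ha : σ a = q • a)
    (r : ℕ) (hsum : ∑ s ∈ Finset.range r, q ^ s • (skewShift σ δ c m ^ (r - 1 - s)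
      * Algebra.lsmul k k (ZMod m → A) (δ a) * skewShift σ δ c m ^ s) = 0) :
    skewShift σ δ c m ^ r * Algebra.lsmul k k (ZMod m → A) a
      = Algebra.lsmul k k (ZMod m → A) ((σ ^ r) a) * skewShift σ δ c m ^ r := by
  have hX := skewShift_mul_lsmul (c := c) (m := m) hδ a
  rw [ha, map_smul, smul_mul_assoc] at hX
  have hpow := pow_mul_of_mul_eq (k := k) (E := Module.End k (ZMod m → A)) hX r
  rw [hsum, add_zero] at hpow
  rw [hpow, pow_apply_eq_smul ha, map_smul, smul_mul_assoc]

theorem skewShift_commute_skewShiftRight (hδ : IsSkewDerivation σ δ) (hσc : σ c = c)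
    (hδc : δ c = 0) : Commute (skewShift σ δ c m) (skewShiftRight k c m) := by
  have hσ (r : ZMod m) : σ (if r = 0 then c else 1) = if r = 0 then c else 1 := by
    split_ifs
    exacts [hσc, map_one σ]
  have hδ' (r : ZMod m) : δ (if r = 0 then c else 1) = 0 := by
    split_ifs
    exacts [hδc, hδ.map_one]
  refine LinearMap.ext fun v => funext fun r => ?_
  simp only [Module.End.mul_apply, skewShift_apply, skewShiftRight_apply, hδ _ (ite _ _ _),
    map_mul, hσ, hδ', mul_zero, zero_add, add_mul]

theorem lsmul_commute_skewShiftRight (a : A) :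
    Commute (Algebra.lsmul k k (ZMod m → A) a) (skewShiftRight k c m) :=
  LinearMap.ext fun v => funext fun r => by
    simp [skewShiftRight_apply, mul_assoc]

theorem skewShift_single (hδ : IsSkewDerivation σ δ) (s : ZMod m) :
    skewShift σ δ c m (Pi.single s 1) = Pi.single (s + 1) (if s + 1 = 0 then c else 1) := by
  funext r
  have hδ1 : δ ((Pi.single s (1 : A) : ZMod m → A) r) = 0 := by
    rw [Pi.single_apply]
    split_ifs
    exacts [hδ.map_one, map_zero δ]
  rw [skewShift_apply, hδ1, zero_add]
  obtain rfl | hr := eq_or_ne r (s + 1)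
  · simp
  · simp [hr, sub_eq_iff_eq_add]

theorem skewShift_pow_single (hδ : IsSkewDerivation σ δ) {s : ℕ} (hs : s < m) :
    (skewShift σ δ c m ^ s) (Pi.single 0 1) = Pi.single (s : ZMod m) 1 := by
  induction s with
  | zero => simp
  | succ s ih =>
    have hs0 : (s : ZMod m) + 1 ≠ 0 := by
      rw [← Nat.cast_succ, Ne, ZMod.natCast_eq_zero_iff]
      exact Nat.not_dvd_of_pos_of_lt s.succ_pos hs
    rw [pow_succ', Module.End.mul_apply, ih (by omega), skewShift_single hδ, if_neg hs0,
      Nat.cast_succ]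

theorem skewShift_pow_self_single (hδ : IsSkewDerivation σ δ) [NeZero m] :
    (skewShift σ δ c m ^ m) (Pi.single 0 1) = Pi.single 0 c := by
  have hm : ((m - 1 : ℕ) : ZMod m) + 1 = 0 := by
    rw [← Nat.cast_succ, Nat.succ_eq_add_one, Nat.sub_add_cancel NeZero.one_le, ZMod.natCast_self]
  rw [← mul_pow_sub_one (NeZero.ne m), Module.End.mul_apply,
    skewShift_pow_single hδ (Nat.sub_one_lt (NeZero.ne m)), skewShift_single hδ, if_pos hm, hm]

theorem skewShift_pow_self_single_one (hδ : IsSkewDerivation σ δ) [NeZero m] (hσc : σ c = c)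
    (hδc : δ c = 0) (r : ZMod m) :
    (skewShift σ δ c m ^ m) (Pi.single r 1) = c • Pi.single r 1 := by
  have hright : (skewShiftRight k c m ^ r.val) (Pi.single 0 1) = Pi.single r (1 : A) := by
    rw [skewShiftRight, skewShift_pow_single (fun _ _ => by simp) r.val_lt,
      ZMod.natCast_zmod_val]
  have hzero : (Pi.single 0 c : ZMod m → A)
      = Algebra.lsmul k k (ZMod m → A) c (Pi.single 0 1) := by
    simp [← Pi.single_smul]
  rw [← hright, ← Module.End.mul_apply,
    ((skewShift_commute_skewShiftRight hδ hσc hδc).pow_pow m _).eq, Module.End.mul_apply,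
    skewShift_pow_self_single hδ, hzero, ← Module.End.mul_apply,
    ← ((lsmul_commute_skewShiftRight c).pow_right _).eq, Module.End.mul_apply, Algebra.lsmul_coe]

theorem skewShift_pow_self {s : Set A} (hs : Algebra.adjoin k s = ⊤) (hδ : IsSkewDerivation σ δ)
    [NeZero m] (hσc : σ c = c) (hδc : δ c = 0) (hc : ∀ a ∈ s, c * a = (σ ^ m) a * c)
    (hX : ∀ a ∈ s, skewShift σ δ c m ^ m * Algebra.lsmul k k (ZMod m → A) a
      = Algebra.lsmul k k (ZMod m → A) ((σ ^ m) a) * skewShift σ δ c m ^ m) :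
    skewShift σ δ c m ^ m = Algebra.lsmul k k (ZMod m → A) c := by
  have hc := mul_eq_mul_of_adjoin_eq_top hs (f := AlgHom.id k A) (g := σ ^ m) hc
  have hX := mul_eq_mul_of_adjoin_eq_top hs
    (g := (Algebra.lsmul k k (ZMod m → A)).comp (σ ^ m)) hX
  refine LinearMap.pi_ext fun r a => ?_
  have ha : (Pi.single r a : ZMod m → A)
      = Algebra.lsmul k k (ZMod m → A) a (Pi.single r 1) := by
    simp [← Pi.single_smul]
  rw [ha, ← Module.End.mul_apply, hX, Module.End.mul_apply,
    skewShift_pow_self_single_one hδ hσc hδc]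
  simp only [AlgHom.comp_apply, Algebra.lsmul_coe, smul_smul, ← hc a, AlgHom.id_apply]

end skewShift

namespace LiftingDatum

section generators

variable {k G : Type*} [Field k] [CommGroup G] {n : ℕ} (D : LiftingDatum k G n)

theorem adjoin_generators : Algebra.adjoin k (Set.range D.grp ∪ Set.range D.x) = ⊤ := by
  have hrange : (Set.range D.grp ∪ Set.range D.x)
      = D.proj '' Set.range (FreeAlgebra.ι k (X := G ⊕ Fin n)) := by
    rw [← Set.range_comp, Sum.range_eq]
    rfl
  rw [hrange, ← AlgHom.map_adjoin, FreeAlgebra.adjoin_range_ι, Algebra.map_top,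
    AlgHom.range_eq_top]
  exact RingQuot.mkAlgHom_surjective k D.Rel

theorem induction_on {p : D.H → Prop} (a : D.H) (grp : ∀ h, p (D.grp h)) (x : ∀ i, p (D.x i))
    (smul : ∀ (c : k) a, p a → p (c • a)) (add : ∀ a b, p a → p b → p (a + b))
    (mul : ∀ a b, p a → p b → p (a * b)) : p a := by
  have ha : a ∈ Algebra.adjoin k (Set.range D.grp ∪ Set.range D.x) :=
    D.adjoin_generators ▸ Algebra.mem_top
  induction ha using Algebra.adjoin_induction with
  | mem a ha =>
    obtain ⟨h, rfl⟩ | ⟨i, rfl⟩ := ha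
    exacts [grp h, x i]
  | algebraMap c =>
    rw [Algebra.algebraMap_eq_smul_one, ← map_one D.grp]
    exact smul c _ (grp 1)
  | add a b _ _ ha hb => exact add a b ha hb
  | mul a b _ _ ha hb => exact mul a b ha hb

theorem eq_top_of_mul_mem {N : Submodule k D.H} (one_mem : 1 ∈ N)
    (mul_grp_mem : ∀ a ∈ N, ∀ h, a * D.grp h ∈ N) (mul_x_mem : ∀ a ∈ N, ∀ i, a * D.x i ∈ N) :
    N = ⊤ := by
  refine N.eq_top_iff'.mpr fun b => ?_
  suffices ∀ a ∈ N, a * b ∈ N by simpa using this 1 one_mem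
  induction b using D.induction_on with
  | grp h => exact fun a ha => mul_grp_mem a ha h
  | x i => exact fun a ha => mul_x_mem a ha i
  | smul c b hb => exact fun a ha => mul_smul_comm c a b ▸ N.smul_mem c (hb a ha)
  | add b b' hb hb' => exact fun a ha => mul_add a b b' ▸ N.add_mem (hb a ha) (hb' a ha)
  | mul b b' hb hb' => exact fun a ha => mul_assoc a b b' ▸ hb' _ (hb a ha)

theorem grp_mul_grp_inv (h : G) : D.grp h * D.grp h⁻¹ = 1 := by
  rw [← map_mul, mul_inv_cancel, map_one]

theorem grp_inv_mul_grp (h : G) : D.grp h⁻¹ * D.grp h = 1 := by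
  rw [← map_mul, inv_mul_cancel, map_one]

theorem x_mul_grp (h : G) (i : Fin n) :
    D.x i * D.grp h = (((D.χ i h)⁻¹ : kˣ) : k) • (D.grp h * D.x i) := by
  rw [grp_mul_x, smul_smul, Units.inv_mul, one_smul]

/-- The elements `y_i = x_i g_i⁻¹`, whose ordered products are the monomials. -/
noncomputable def y (i : Fin n) : D.H := D.x i * D.grp (D.g i)⁻¹

theorem y_mul_grp (i : Fin n) : D.y i * D.grp (D.g i) = D.x i := by
  rw [y, mul_assoc, grp_inv_mul_grp, mul_one]

theorem grp_mul_y (h : G) (i : Fin n) :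
    D.grp h * D.y i = (D.χ i h : k) • (D.y i * D.grp h) := by
  rw [y, ← mul_assoc, grp_mul_x, smul_mul_assoc, mul_assoc, mul_assoc, ← map_mul, ← map_mul,
    mul_comm h]

theorem exists_y_pow_eq_smul (i : Fin n) (r : ℕ) :
    ∃ c : k, D.y i ^ r = c • (D.x i ^ r * D.grp ((D.g i)⁻¹ ^ r)) := by
  induction r with
  | zero => exact ⟨1, by simp⟩
  | succ r ih =>
    obtain ⟨c, hc⟩ := ih
    refine ⟨c * D.χ i ((D.g i)⁻¹ ^ r), ?_⟩
    rw [pow_succ, hc, y, smul_mul_assoc, ← mul_assoc (_ * _), mul_assoc (D.x i ^ r), grp_mul_x,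
      mul_smul, mul_smul_comm, smul_mul_assoc, ← mul_assoc, ← pow_succ, mul_assoc, ← map_mul,
      ← pow_succ]

theorem one_lt_m [Finite G] (i : Fin n) : 1 < D.m i :=
  lt_of_le_of_ne (D.m_pos i) (Ne.symm (orderOf_eq_one_iff.not.mpr (D.χ_self_ne_one i)))

instance [Finite G] (i : Fin n) : NeZero (D.m i) := ⟨(D.m_pos i).ne'⟩

end generators

section zero

variable {k G : Type*} [Field k] [CommGroup G] (D : LiftingDatum k G 0)

/-- Without generators `x_i` the lifting is the group algebra of `G`. -/
noncomputable def zeroEquiv : D.H ≃ₐ[k] MonoidAlgebra k G :=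
  AlgEquiv.ofAlgHom
    (D.lift (MonoidAlgebra.of k G) Fin.elim0 (fun _ i => i.elim0) (fun i => i.elim0)
      fun i => i.elim0)
    (MonoidAlgebra.lift k D.H G D.grp)
    (MonoidAlgebra.algHom_ext (fun h => by simp [D.lift_grp]) (Subsingleton.elim _ _))
    (D.algHom_ext (fun h => by simp [D.lift_grp]) fun i => i.elim0)

theorem zeroEquiv_grp (h : G) : D.zeroEquiv (D.grp h) = MonoidAlgebra.of k G h :=
  D.lift_grp _ _ _ _ _ h

/-- Without generators `x_i` the group elements form a basis. -/
noncomputable def zeroBasis : Module.Basis G k D.H :=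
  (MonoidAlgebra.basis G k).map D.zeroEquiv.symm.toLinearEquiv

theorem zeroBasis_apply (h : G) : D.zeroBasis h = D.grp h := by
  simpa [zeroBasis] using D.zeroEquiv.symm_apply_eq.mpr (D.zeroEquiv_grp h).symm

end zero

section tail

variable {k G : Type*} [Field k] [CommGroup G] {n : ℕ} (D : LiftingDatum k G (n + 1))

/-- The datum obtained by forgetting the first generator. -/
@[simps] def tail : LiftingDatum k G n where
  g i := D.g i.succ
  χ i := D.χ i.succ
  lam i := D.lam i.succ
  lamLink i j := D.lamLink i.succ j.succ
  χ_self_ne_one i := D.χ_self_ne_one i.succ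
  χ_mul_χ i j hij := D.χ_mul_χ i.succ j.succ (by simpa using hij)
  lam_mul i := D.lam_mul i.succ
  lamLink_mul i j hij := D.lamLink_mul i.succ j.succ (by simpa using hij)
  lamLink_add i j hij := D.lamLink_add i.succ j.succ (by simpa using hij)

/-- The canonical map from the lifting with the first generator forgotten. -/
noncomputable def tailHom : D.tail.H →ₐ[k] D.H :=
  D.tail.lift D.grp (fun i => D.x i.succ) (fun h i => D.grp_mul_x h i.succ)
    (fun i j hij => D.x_mul_x (i := i.succ) (j := j.succ) (by simpa using hij))
    (fun i => D.x_pow i.succ)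

@[simp] theorem tailHom_grp (h : G) : D.tailHom (D.tail.grp h) = D.grp h :=
  D.tail.lift_grp _ _ _ _ _ h

@[simp] theorem tailHom_x (i : Fin n) : D.tailHom (D.tail.x i) = D.x i.succ :=
  D.tail.lift_x _ _ _ _ _ i

theorem monomial_cons (s : ZMod (D.m 0)) (r : ∀ i, ZMod (D.tail.m i)) (h : G) :
    D.monomial (Fin.cons (α := fun i => ZMod (D.m i)) s r) h
      = D.y 0 ^ s.val * D.tailHom (D.tail.monomial r h) := by
  have htail : (D.tailHom ∘ fun i => (D.tail.x i * D.tail.grp (D.tail.g i)⁻¹) ^ (r i).val)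
      = fun i => (D.x i.succ * D.grp (D.g i.succ)⁻¹) ^ (r i).val := by
    funext i
    simp
  rw [monomial, monomial, List.ofFn_succ, List.prod_cons, map_mul, map_list_prod, List.map_ofFn,
    tailHom_grp, htail, mul_assoc]
  rfl

theorem exists_tailHom_mul_y (a : D.tail.H) :
    ∃ b c, D.tailHom a * D.y 0 = D.y 0 * D.tailHom b + D.tailHom c := by
  induction a using D.tail.induction_on with
  | grp h => exact ⟨(D.χ 0 h : k) • D.tail.grp h, 0, by simp [grp_mul_y]⟩
  | x i =>
    refine ⟨(D.q i.succ 0 : k) • (D.tail.grp (D.g 0) * D.tail.x i * D.tail.grp (D.g 0)⁻¹),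
      D.lamLink i.succ 0 • ((1 - D.tail.grp (D.g i.succ * D.g 0)) * D.tail.grp (D.g 0)⁻¹), ?_⟩
    simp only [map_smul, map_mul, map_sub, map_one, tailHom_grp, tailHom_x, mul_smul_comm,
      ← mul_assoc, y_mul_grp]
    rw [y, ← mul_assoc, D.x_mul_x (Fin.succ_ne_zero i), add_mul, smul_mul_assoc, smul_mul_assoc,
      map_mul]
  | smul t a ha =>
    obtain ⟨b, c, h⟩ := ha
    exact ⟨t • b, t • c, by simp only [map_smul, smul_mul_assoc, h, smul_add, mul_smul_comm]⟩
  | add a a' ha ha' =>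
    obtain ⟨b, c, h⟩ := ha
    obtain ⟨b', c', h'⟩ := ha'
    refine ⟨b + b', c + c', ?_⟩
    simp only [map_add, add_mul, h, h', mul_add]
    abel
  | mul a a' ha ha' =>
    obtain ⟨b, c, h⟩ := ha
    obtain ⟨b', c', h'⟩ := ha'
    refine ⟨b * b', c * b' + a * c', ?_⟩
    rw [map_mul, mul_assoc, h', mul_add, ← mul_assoc, h]
    simp only [map_add, map_mul, add_mul, mul_assoc, add_assoc]

theorem y_zero_pow_m_mem_range_tailHom : D.y 0 ^ D.m 0 ∈ D.tailHom.range := by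
  obtain ⟨c, hc⟩ := D.exists_y_pow_eq_smul 0 (D.m 0)
  rw [hc, x_pow]
  refine ⟨c • (D.lam 0 • (1 - D.tail.grp (D.g 0 ^ D.m 0))
    * D.tail.grp ((D.g 0)⁻¹ ^ D.m 0)), ?_⟩
  simp

variable [Finite G]

/-- The decomposition `H = ⨁ y_0 ^ s H'` for `0 ≤ s < m_0`, where `H'` is the lifting with the
first generator forgotten. -/
noncomputable def tailDecomp : (ZMod (D.m 0) → D.tail.H) →ₗ[k] D.H :=
  ∑ s : ZMod (D.m 0), LinearMap.mulLeft k (D.y 0 ^ s.val) ∘ₗ D.tailHom.toLinearMap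
    ∘ₗ LinearMap.proj s

theorem tailDecomp_apply (v : ZMod (D.m 0) → D.tail.H) :
    D.tailDecomp v = ∑ s, D.y 0 ^ s.val * D.tailHom (v s) := by
  simp [tailDecomp]

theorem tailDecomp_single (s : ZMod (D.m 0)) (a : D.tail.H) :
    D.tailDecomp (Pi.single s a) = D.y 0 ^ s.val * D.tailHom a := by
  rw [tailDecomp_apply, Finset.sum_eq_single s _ (by simp)]
  · rw [Pi.single_eq_same]
  · intro t _ hts
    rw [Pi.single_eq_of_ne hts, map_zero, mul_zero]

theorem y_zero_pow_mul_tailHom_mem_range_tailDecomp {r : ℕ} (hr : r ≤ D.m 0) (a : D.tail.H) :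
    D.y 0 ^ r * D.tailHom a ∈ LinearMap.range D.tailDecomp := by
  obtain hr | rfl := hr.lt_or_eq
  · exact ⟨Pi.single r a, by rw [tailDecomp_single, ZMod.val_cast_of_lt hr]⟩
  · obtain ⟨b, hb⟩ := D.y_zero_pow_m_mem_range_tailHom
    refine ⟨Pi.single 0 (b * a), ?_⟩
    rw [tailDecomp_single, ZMod.val_zero, pow_zero, one_mul, map_mul, ← hb]
    rfl

theorem tailDecomp_mul_tailHom_mem_range (v : ZMod (D.m 0) → D.tail.H) (a : D.tail.H) :
    D.tailDecomp v * D.tailHom a ∈ LinearMap.range D.tailDecomp :=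
  ⟨fun s => v s * a, by simp [tailDecomp_apply, Finset.sum_mul, mul_assoc]⟩

theorem tailDecomp_mul_y_zero_mem_range (v : ZMod (D.m 0) → D.tail.H) :
    D.tailDecomp v * D.y 0 ∈ LinearMap.range D.tailDecomp := by
  rw [tailDecomp_apply, Finset.sum_mul]
  refine Submodule.sum_mem _ fun s _ => ?_
  obtain ⟨b, c, h⟩ := D.exists_tailHom_mul_y (v s)
  rw [mul_assoc, h, mul_add, ← mul_assoc, ← pow_succ]
  exact Submodule.add_mem _
    (D.y_zero_pow_mul_tailHom_mem_range_tailDecomp (ZMod.val_lt s) b)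
    (D.y_zero_pow_mul_tailHom_mem_range_tailDecomp (ZMod.val_lt s).le c)

theorem tailDecomp_surjective : Function.Surjective D.tailDecomp := by
  rw [← LinearMap.range_eq_top]
  refine D.eq_top_of_mul_mem ?_ ?_ ?_
  · simpa using D.y_zero_pow_mul_tailHom_mem_range_tailDecomp (Nat.zero_le _) 1
  · rintro _ ⟨v, rfl⟩ h
    simpa using D.tailDecomp_mul_tailHom_mem_range v (D.tail.grp h)
  · rintro _ ⟨v, rfl⟩ i
    cases i using Fin.cases with
    | zero =>
      obtain ⟨w, hw⟩ := D.tailDecomp_mul_y_zero_mem_range v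
      rw [← y_mul_grp, ← mul_assoc, ← hw]
      simpa using D.tailDecomp_mul_tailHom_mem_range w (D.tail.grp (D.g 0))
    | succ i => simpa using D.tailDecomp_mul_tailHom_mem_range v (D.tail.x i)

end tail

instance {k G : Type*} [Field k] [CommGroup G] [Finite G] {n : ℕ}
    (D : LiftingDatum k G n) : Module.Finite k D.H := by
  induction n with
  | zero => exact .of_basis D.zeroBasis
  | succ n ih =>
    have := ih D.tail
    exact Module.Finite.of_surjective D.tailDecomp D.tailDecomp_surjective

end LiftingDatum

theorem smul_smul_one_sub {k E : Type*} [Field k] [Ring E] [Algebra k E] {c l : k} (h : l * c = l)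
    (e : E) : c • l • (1 - e) = l • (1 - c • e) := by
  simp only [smul_sub, smul_smul, mul_comm c, h]

namespace LiftingDatum

section scalars

variable {k G : Type*} [Field k] [CommGroup G] {n : ℕ} (D : LiftingDatum k G n)

theorem q_eq_inv_χ {i j : Fin n} (hij : i ≠ j) : D.q j i = (D.χ j (D.g i))⁻¹ := by
  rw [q, eq_inv_iff_mul_eq_one, D.χ_mul_χ i j hij]

theorem q_pow_m (i : Fin n) : D.q i i ^ D.m i = 1 := pow_orderOf_eq_one _

theorem lam_mul_χ_pow (i : Fin n) (h : G) : D.lam i * (D.χ i h : k) ^ D.m i = D.lam i :=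
  sub_eq_zero.mp (by rw [← mul_sub_one]; exact D.lam_mul i h)

theorem lam_mul_q_pow (i j : Fin n) : D.lam j * (D.q i j : k) ^ D.m j = D.lam j :=
  D.lam_mul_χ_pow j (D.g i)

theorem lamLink_mul_χ_mul_χ {i j : Fin n} (hij : i ≠ j) (h : G) :
    D.lamLink i j * (D.χ i h * D.χ j h) = D.lamLink i j :=
  sub_eq_zero.mp (by rw [← mul_sub_one]; exact D.lamLink_mul i j hij h)

theorem lamLink_mul_q_mul_q {i j : Fin n} (hij : i ≠ j) (l : Fin n) :
    D.lamLink i j * (D.q l i * D.q l j) = D.lamLink i j :=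
  D.lamLink_mul_χ_mul_χ hij (D.g l)

theorem χ_eq_inv_of_lamLink_ne_zero {i j : Fin n} (hij : i ≠ j) (h : D.lamLink i j ≠ 0) (t : G) :
    D.χ j t = (D.χ i t)⁻¹ := by
  rw [eq_inv_iff_mul_eq_one, mul_comm]
  ext
  simpa [h] using D.lamLink_mul_χ_mul_χ hij t

end scalars

section skew

variable {k G : Type*} [Field k] [CommGroup G] {n : ℕ} (D : LiftingDatum k G (n + 1))

theorem tail_q (i j : Fin n) : D.tail.q i j = D.q i.succ j.succ := rfl

theorem tail_m (i : Fin n) : D.tail.m i = D.m i.succ := rfl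

/-- The action of `G` on `x_0` by conjugation, as a twisted embedding of `G`. -/
noncomputable def twistGrp : G →* D.tail.H where
  toFun h := (((D.χ 0 h)⁻¹ : kˣ) : k) • D.tail.grp h
  map_one' := by simp
  map_mul' a b := by simp [smul_smul, mul_comm]

theorem twistGrp_apply (h : G) :
    D.twistGrp h = (((D.χ 0 h)⁻¹ : kˣ) : k) • D.tail.grp h := rfl

theorem inv_χ_g_succ (j : Fin n) : (D.χ 0 (D.g j.succ))⁻¹ = D.q 0 j.succ :=
  (D.q_eq_inv_χ (Fin.succ_ne_zero j)).symm

/-- The automorphism `σ` in `x_0 a = σ(a) x_0 + δ(a)`, for `a` in the subalgebra generated by `G`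
and the other generators. -/
noncomputable def twist : D.tail.H →ₐ[k] D.tail.H :=
  D.tail.lift D.twistGrp (fun j => (D.q 0 j.succ : k) • D.tail.x j)
    (fun h j => by
      simp only [twistGrp_apply, smul_mul_smul_comm, grp_mul_x, smul_smul]
      ring_nf)
    (fun i j hij => by
      have hij' : i.succ ≠ j.succ := by simpa using hij
      rw [twistGrp_apply, tail_g, tail_g, map_mul (D.χ 0), mul_inv, inv_χ_g_succ, inv_χ_g_succ,
        Units.val_mul, tail_lamLink, ← smul_smul_one_sub (D.lamLink_mul_q_mul_q hij' 0),
        smul_mul_smul_comm, smul_mul_smul_comm, D.tail.x_mul_x hij, smul_add,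
        smul_comm _ (D.tail.q i j : k), mul_comm (D.q 0 i.succ : k)]
      rfl)
    (fun j => by
      rw [twistGrp_apply, tail_g, tail_m, map_pow (D.χ 0), ← inv_pow, inv_χ_g_succ,
        Units.val_pow_eq_pow_val, tail_lam, ← smul_smul_one_sub (D.lam_mul_q_pow 0 j.succ),
        smul_pow, ← tail_m, D.tail.x_pow]
      rfl)

@[simp] theorem twist_grp (h : G) :
    D.twist (D.tail.grp h) = (((D.χ 0 h)⁻¹ : kˣ) : k) • D.tail.grp h :=
  D.tail.lift_grp _ _ _ _ _ h

@[simp] theorem twist_x (j : Fin n) : D.twist (D.tail.x j) = (D.q 0 j.succ : k) • D.tail.x j :=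
  D.tail.lift_x _ _ _ _ _ j

/-- The value at `x_j` of the skew derivation `δ` in `x_0 a = σ(a) x_0 + δ(a)`. -/
noncomputable def skewDerX (j : Fin n) : D.tail.H :=
  D.lamLink 0 j.succ • (1 - D.tail.grp (D.g 0 * D.g j.succ))

theorem twist_grp_mul_skewDerX (h : G) (j : Fin n) : D.twist (D.tail.grp h) * D.skewDerX j
    = (D.χ j.succ h : k) • (D.skewDerX j * D.tail.grp h) := by
  have hcomm : D.tail.grp h * (1 - D.tail.grp (D.g 0 * D.g j.succ))
      = (1 - D.tail.grp (D.g 0 * D.g j.succ)) * D.tail.grp h := by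
    rw [mul_one_sub, one_sub_mul, ← map_mul, ← map_mul, mul_comm h]
  obtain h0 | h0 := eq_or_ne (D.lamLink 0 j.succ) 0
  · simp [skewDerX, h0]
  · rw [D.χ_eq_inv_of_lamLink_ne_zero (Fin.succ_ne_zero j).symm h0, twist_grp, skewDerX,
      smul_mul_smul_comm, hcomm, smul_mul_assoc, smul_smul]

theorem twist_x_mul_skewDerX {i j : Fin n} (hij : i ≠ j) :
    D.twist (D.tail.x i) * D.skewDerX j
      = (D.q i.succ j.succ : k) • (D.skewDerX j * D.tail.x i) := by
  obtain h0 | h0 := eq_or_ne (D.lamLink 0 j.succ) 0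
  · simp [skewDerX, h0]
  have hχ := D.χ_eq_inv_of_lamLink_ne_zero (Fin.succ_ne_zero j).symm h0 (D.g i.succ)
  have hq : D.q i.succ j.succ = D.q 0 i.succ := by rw [q, hχ, inv_χ_g_succ]
  have hone : D.χ i.succ (D.g 0 * D.g j.succ) = 1 := by
    rw [map_mul, ← inv_inv (D.χ i.succ (D.g j.succ)), ← D.q_eq_inv_χ (by simpa using hij.symm), hq]
    exact mul_inv_cancel _
  have hcomm : D.tail.x i * (1 - D.tail.grp (D.g 0 * D.g j.succ))
      = (1 - D.tail.grp (D.g 0 * D.g j.succ)) * D.tail.x i := by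
    rw [mul_one_sub, one_sub_mul, grp_mul_x, tail_χ, hone, Units.val_one, one_smul]
  rw [twist_x, skewDerX, smul_mul_smul_comm, hcomm, hq, smul_mul_assoc, smul_smul]

theorem sum_twist_x_pow_mul_skewDerX_mul_x_pow (j : Fin n) :
    ∑ s ∈ Finset.range (D.m j.succ), D.twist (D.tail.x j) ^ (D.m j.succ - 1 - s)
      * D.skewDerX j * D.tail.x j ^ s = 0 := by
  obtain h0 | h0 := eq_or_ne (D.lamLink 0 j.succ) 0
  · simp [skewDerX, h0]
  have hq : D.q 0 j.succ = D.q j.succ j.succ := by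
    rw [← inv_χ_g_succ, ← D.χ_eq_inv_of_lamLink_ne_zero (Fin.succ_ne_zero j).symm h0]
    rfl
  have hχ : (D.tail.χ j (D.g 0 * D.g j.succ))⁻¹ = (D.q 0 j.succ * D.q 0 j.succ)⁻¹ := by
    rw [map_mul, inv_inj]
    exact congrArg (D.q 0 j.succ * ·) hq.symm
  have hqχ : D.q 0 j.succ * (D.tail.χ j (D.g 0 * D.g j.succ))⁻¹ = (D.q 0 j.succ)⁻¹ := by
    rw [hχ, mul_inv, mul_inv_cancel_left]
  have hq1 : D.q 0 j.succ ≠ 1 := hq ▸ D.χ_self_ne_one j.succ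
  have hqm : D.q 0 j.succ ^ D.m j.succ = 1 := hq ▸ D.q_pow_m j.succ
  have hsum := sum_smul_pow_mul_one_sub_mul_pow_eq_zero (a := (1 : k)) (b := D.q 0 j.succ)
    (r := D.m j.succ) (D.tail.x_mul_grp (D.g 0 * D.g j.succ) j)
    (by rw [one_pow, ← Units.val_pow_eq_pow_val, hqm, Units.val_one])
    (by rw [Ne, eq_comm, Units.val_eq_one]; exact hq1)
    (by rw [one_pow, ← Units.val_mul, hqχ, ← Units.val_pow_eq_pow_val, inv_pow, hqm, inv_one,
      Units.val_one])
    (by rw [← Units.val_mul, hqχ]; simpa using hq1)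
  simp only [one_pow, one_mul] at hsum
  simp only [twist_x, skewDerX, smul_pow, smul_mul_assoc, mul_smul_comm,
    ← Finset.smul_sum, hsum, smul_zero]

theorem one_sub_skewBlock_grp (h : G) : 1 - skewBlock D.twist (D.tail.grp h) 0
    = skewBlock D.twist (1 - D.tail.grp h) 0 := by
  rw [← skewBlock_one D.twist, skewBlock_sub, sub_zero]

/-- The algebra map `a ↦ skewBlock σ a (δ a)`, for `σ` and `δ` as in `x_0 a = σ(a) x_0 + δ(a)`. -/
noncomputable def skewMat : D.tail.H →ₐ[k] Matrix (Fin 2) (Fin 2) D.tail.H :=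
  D.tail.lift
    { toFun h := skewBlock D.twist (D.tail.grp h) 0
      map_one' := by rw [map_one, skewBlock_one]
      map_mul' a b := by rw [skewBlock_mul, map_mul, mul_zero, zero_mul, add_zero] }
    (fun j => skewBlock D.twist (D.tail.x j) (D.skewDerX j))
    (fun h j => by
      simp only [MonoidHom.coe_mk, OneHom.coe_mk, skewBlock_mul, skewBlock_smul, zero_mul, mul_zero,
        zero_add, add_zero, grp_mul_x, twist_grp_mul_skewDerX]
      rfl)
    (fun i j hij => by
      have hq : (D.q i.succ j.succ : k) * D.q j.succ i.succ = 1 := by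
        rw [D.q_eq_inv_χ (by simpa using hij.symm)]
        exact Units.mul_inv _
      simp only [MonoidHom.coe_mk, OneHom.coe_mk, one_sub_skewBlock_grp, skewBlock_mul,
        skewBlock_smul, skewBlock_add, smul_zero, add_zero, D.tail.x_mul_x hij,
        D.twist_x_mul_skewDerX hij, D.twist_x_mul_skewDerX hij.symm, tail_q, smul_add, smul_smul,
        hq, one_smul, add_comm])
    (fun j => by
      simp only [MonoidHom.coe_mk, OneHom.coe_mk, one_sub_skewBlock_grp, skewBlock_pow,
        skewBlock_smul, smul_zero, D.tail.x_pow]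
      rw [tail_m, sum_twist_x_pow_mul_skewDerX_mul_x_pow])

theorem skewMat_grp (h : G) :
    D.skewMat (D.tail.grp h) = skewBlock D.twist (D.tail.grp h) 0 :=
  D.tail.lift_grp _ _ _ _ _ h

theorem skewMat_x (j : Fin n) :
    D.skewMat (D.tail.x j) = skewBlock D.twist (D.tail.x j) (D.skewDerX j) :=
  D.tail.lift_x _ _ _ _ _ j

theorem skewMat_eq_skewBlock (a : D.tail.H) :
    D.skewMat a = skewBlock D.twist a (D.skewMat a 0 1) := by
  induction a using D.tail.induction_on with
  | grp h => rw [skewMat_grp]; rfl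
  | x i => rw [skewMat_x]; rfl
  | smul c a ha => rw [map_smul, ha, skewBlock_smul]; rfl
  | add a b ha hb => rw [map_add, ha, hb, skewBlock_add]; rfl
  | mul a b ha hb => rw [map_mul, ha, hb, skewBlock_mul]; rfl

/-- The skew derivation `δ` in `x_0 a = σ(a) x_0 + δ(a)`. -/
noncomputable def skewDer : D.tail.H →ₗ[k] D.tail.H :=
  Matrix.entryLinearMap k D.tail.H 0 1 ∘ₗ D.skewMat.toLinearMap

theorem isSkewDerivation_skewDer : IsSkewDerivation D.twist D.skewDer :=
  isSkewDerivation_of_forall_eq_skewBlock D.twist D.skewMat_eq_skewBlock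

@[simp] theorem skewDer_grp (h : G) : D.skewDer (D.tail.grp h) = 0 := by
  simp [skewDer, skewMat_grp, skewBlock]

@[simp] theorem skewDer_x (j : Fin n) : D.skewDer (D.tail.x j) = D.skewDerX j := by
  simp [skewDer, skewMat_x, skewBlock]

end skew

section shift

variable {k G : Type*} [Field k] [CommGroup G] {n : ℕ} (D : LiftingDatum k G (n + 1))

/-- The value prescribed for `x_0 ^ m_0`. -/
noncomputable def powValue : D.tail.H := D.lam 0 • (1 - D.tail.grp (D.g 0 ^ D.m 0))

theorem twist_powValue : D.twist D.powValue = D.powValue := by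
  rw [powValue, map_smul, map_sub, map_one, twist_grp, map_pow (D.χ 0)]
  simp [show D.χ 0 (D.g 0) ^ D.m 0 = 1 from D.q_pow_m 0]

theorem skewDer_powValue : D.skewDer D.powValue = 0 := by
  rw [powValue, map_smul, map_sub, D.isSkewDerivation_skewDer.map_one, skewDer_grp, sub_zero,
    smul_zero]

theorem lam_zero_mul_inv_χ_pow (h : G) :
    D.lam 0 * (((D.χ 0 h)⁻¹ : kˣ) : k) ^ D.m 0 = D.lam 0 := by
  rw [← map_inv]
  exact D.lam_mul_χ_pow 0 h⁻¹

theorem powValue_mul_grp (h : G) :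
    D.powValue * D.tail.grp h = (D.twist ^ D.m 0) (D.tail.grp h) * D.powValue := by
  rw [pow_apply_eq_smul (D.twist_grp h), powValue, smul_mul_smul_comm, mul_comm _ (D.lam 0),
    lam_zero_mul_inv_χ_pow, smul_mul_assoc, mul_one_sub, one_sub_mul, ← map_mul, ← map_mul,
    mul_comm h]

theorem powValue_mul_x (j : Fin n) :
    D.powValue * D.tail.x j = (D.twist ^ D.m 0) (D.tail.x j) * D.powValue := by
  have hlam : D.lam 0 * (D.q 0 j.succ : k) ^ D.m 0 = D.lam 0 := by
    rw [← inv_χ_g_succ, lam_zero_mul_inv_χ_pow]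
  have hχ : (D.tail.χ j (D.g 0 ^ D.m 0) : k) = (D.q 0 j.succ : k) ^ D.m 0 := by
    rw [map_pow, Units.val_pow_eq_pow_val]
    rfl
  rw [pow_apply_eq_smul (D.twist_x j), powValue, smul_mul_smul_comm, mul_comm _ (D.lam 0), hlam,
    smul_mul_assoc, mul_one_sub, one_sub_mul, grp_mul_x, hχ, smul_sub, smul_smul, hlam, smul_sub]

/-- The action of the lifting with the first generator forgotten on `⨁ H' x_0 ^ s`, `0 ≤ s < m_0`,
by left multiplication. -/
noncomputable abbrev lmul : D.tail.H →ₐ[k] Module.End k (ZMod (D.m 0) → D.tail.H) :=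
  Algebra.lsmul k k (ZMod (D.m 0) → D.tail.H)

/-- The action of `x_0` on `⨁ H' x_0 ^ s`, `0 ≤ s < m_0`, by left multiplication. -/
noncomputable def shift : Module.End k (ZMod (D.m 0) → D.tail.H) :=
  skewShift D.twist D.skewDer D.powValue (D.m 0)

theorem shift_mul_lmul_grp (h : G) : D.shift * D.lmul (D.tail.grp h)
    = (((D.χ 0 h)⁻¹ : kˣ) : k) • (D.lmul (D.tail.grp h) * D.shift) := by
  rw [shift, skewShift_mul_lsmul D.isSkewDerivation_skewDer, twist_grp, skewDer_grp, map_zero,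
    add_zero, map_smul, smul_mul_assoc]

theorem shift_mul_lmul_x (j : Fin n) : D.shift * D.lmul (D.tail.x j)
    = (D.q 0 j.succ : k) • (D.lmul (D.tail.x j) * D.shift) + D.lmul (D.skewDerX j) := by
  rw [shift, skewShift_mul_lsmul D.isSkewDerivation_skewDer, twist_x, skewDer_x, map_smul,
    smul_mul_assoc]

theorem sum_shift_pow_mul_lmul_skewDerX_mul_shift_pow (j : Fin n) :
    ∑ s ∈ Finset.range (D.m 0), (D.q 0 j.succ : k) ^ s
      • (D.shift ^ (D.m 0 - 1 - s) * D.lmul (D.skewDerX j) * D.shift ^ s) = 0 := by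
  obtain h0 | h0 := eq_or_ne (D.lamLink 0 j.succ) 0
  · simp [skewDerX, h0]
  have hq : D.q 0 j.succ = (D.q 0 0)⁻¹ :=
    D.χ_eq_inv_of_lamLink_ne_zero (Fin.succ_ne_zero j).symm h0 (D.g 0)
  have hχ : (D.χ 0 (D.g 0 * D.g j.succ))⁻¹ = (D.q 0 0)⁻¹ * (D.q 0 0)⁻¹ := by
    rw [map_mul, mul_inv, inv_χ_g_succ, hq]
    rfl
  have hq1 : ((D.q 0 0)⁻¹ : kˣ) ≠ 1 := inv_ne_one.mpr (D.χ_self_ne_one 0)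
  have hqm : (((D.q 0 0)⁻¹ : kˣ) : k) ^ D.m 0 = 1 := by
    rw [← Units.val_pow_eq_pow_val, inv_pow, q_pow_m, inv_one, Units.val_one]
  have hcomm := D.shift_mul_lmul_grp (D.g 0 * D.g j.succ)
  rw [hχ, Units.val_mul] at hcomm
  have hsum := sum_smul_pow_mul_one_sub_mul_pow_eq_zero (k := k)
    (E := Module.End k (ZMod (D.m 0) → D.tail.H)) (a := ((D.q 0 0)⁻¹ : kˣ)) (b := 1)
    (r := D.m 0) hcomm
    (by rw [hqm, one_pow])
    (by rwa [Ne, Units.val_eq_one])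
    (by rw [one_mul, mul_pow, hqm, one_mul])
    (by rw [one_mul, ← Units.val_mul, Ne, Units.val_inj, left_eq_mul]; exact hq1)
  simp only [one_pow, mul_one] at hsum
  simp only [hq, skewDerX, map_smul, map_sub, map_one, mul_smul_comm, smul_mul_assoc,
    smul_comm _ (D.lamLink 0 j.succ), ← Finset.smul_sum, hsum, smul_zero]

theorem shift_pow_mul_lmul_grp (h : G) (r : ℕ) : D.shift ^ r * D.lmul (D.tail.grp h)
    = D.lmul ((D.twist ^ r) (D.tail.grp h)) * D.shift ^ r :=
  skewShift_pow_mul_lsmul D.isSkewDerivation_skewDer (D.twist_grp h) r (by simp)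

theorem shift_pow_m_mul_lmul_x (j : Fin n) : D.shift ^ D.m 0 * D.lmul (D.tail.x j)
    = D.lmul ((D.twist ^ D.m 0) (D.tail.x j)) * D.shift ^ D.m 0 :=
  skewShift_pow_mul_lsmul D.isSkewDerivation_skewDer (D.twist_x j) _
    (by rw [skewDer_x]; exact D.sum_shift_pow_mul_lmul_skewDerX_mul_shift_pow j)

variable [Finite G]

theorem shift_pow_m : D.shift ^ D.m 0 = D.lmul D.powValue := by
  refine skewShift_pow_self D.tail.adjoin_generators D.isSkewDerivation_skewDer D.twist_powValue
    D.skewDer_powValue ?_ ?_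
  · rintro _ (⟨h, rfl⟩ | ⟨j, rfl⟩)
    exacts [D.powValue_mul_grp h, D.powValue_mul_x j]
  · rintro _ (⟨h, rfl⟩ | ⟨j, rfl⟩)
    exacts [D.shift_pow_mul_lmul_grp h _, D.shift_pow_m_mul_lmul_x j]

end shift

section rep

variable {k G : Type*} [Field k] [CommGroup G] {n : ℕ} (D : LiftingDatum k G (n + 1))

/-- The actions of the generators `x_i` on `⨁ H' x_0 ^ s`, `0 ≤ s < m_0`, by left
multiplication. -/
noncomputable def repX : Fin (n + 1) → Module.End k (ZMod (D.m 0) → D.tail.H) :=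
  Fin.cons D.shift fun j => D.lmul (D.tail.x j)

theorem lmul_grp_mul_repX (h : G) (i : Fin (n + 1)) : D.lmul (D.tail.grp h) * D.repX i
    = (D.χ i h : k) • (D.repX i * D.lmul (D.tail.grp h)) := by
  cases i using Fin.cases with
  | zero => rw [repX, Fin.cons_zero, shift_mul_lmul_grp, smul_smul, Units.mul_inv, one_smul]
  | succ j => rw [repX, Fin.cons_succ, ← map_mul, grp_mul_x, map_smul, map_mul]; rfl

theorem lmul_x_mul_shift (j : Fin n) : D.lmul (D.tail.x j) * D.shift
    = (D.q j.succ 0 : k) • (D.shift * D.lmul (D.tail.x j))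
      + D.lamLink j.succ 0 • (1 - D.lmul (D.tail.grp (D.g j.succ * D.g 0))) := by
  have hq : (D.q j.succ 0 : k) * D.q 0 j.succ = 1 := by
    rw [D.q_eq_inv_χ (Fin.succ_ne_zero j).symm]
    exact Units.inv_mul _
  have hlam : D.lamLink j.succ 0 = -(D.q j.succ 0 * D.lamLink 0 j.succ) :=
    eq_neg_of_add_eq_zero_left (D.lamLink_add j.succ 0 (Fin.succ_ne_zero j))
  have hδ : (D.q j.succ 0 : k) • D.skewDerX j
      + D.lamLink j.succ 0 • (1 - D.tail.grp (D.g j.succ * D.g 0)) = 0 := by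
    rw [skewDerX, smul_smul, hlam, neg_smul, mul_comm (D.g j.succ), add_neg_cancel]
  have h := congrArg D.lmul hδ
  rw [map_add, map_smul, map_smul, map_sub, map_one, map_zero] at h
  rw [shift_mul_lmul_x, smul_add, smul_smul, hq, one_smul, add_assoc, h, add_zero]

theorem repX_mul_repX (i j : Fin (n + 1)) (hij : i ≠ j) : D.repX i * D.repX j
    = (D.q i j : k) • (D.repX j * D.repX i)
      + D.lamLink i j • (1 - D.lmul (D.tail.grp (D.g i * D.g j))) := by
  cases i using Fin.cases with
  | zero =>
    cases j using Fin.cases with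
    | zero => exact absurd rfl hij
    | succ j =>
      rw [repX, Fin.cons_zero, Fin.cons_succ, shift_mul_lmul_x, skewDerX, map_smul, map_sub,
        map_one]
  | succ i =>
    cases j using Fin.cases with
    | zero => exact D.lmul_x_mul_shift i
    | succ j =>
      have h := congrArg D.lmul (D.tail.x_mul_x (i := i) (j := j) (by simpa using hij))
      rwa [map_mul, map_add, map_smul, map_smul, map_mul, map_sub, map_one] at h

variable [Finite G]

theorem repX_pow_m (i : Fin (n + 1)) :
    D.repX i ^ D.m i = D.lam i • (1 - D.lmul (D.tail.grp (D.g i ^ D.m i))) := by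
  cases i using Fin.cases with
  | zero => rw [repX, Fin.cons_zero, shift_pow_m, powValue, map_smul, map_sub, map_one]
  | succ j =>
    have h := congrArg D.lmul (D.tail.x_pow j)
    rwa [map_pow, map_smul, map_sub, map_one] at h

/-- The left regular representation of `H`, on the decomposition `H = ⨁ H' x_0 ^ s`,
`0 ≤ s < m_0`, where `H'` is the lifting with the first generator forgotten. -/
noncomputable def rep : D.H →ₐ[k] Module.End k (ZMod (D.m 0) → D.tail.H) :=
  D.lift ((D.lmul : D.tail.H →* Module.End k (ZMod (D.m 0) → D.tail.H)).comp D.tail.grp) D.repX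
    D.lmul_grp_mul_repX D.repX_mul_repX D.repX_pow_m

theorem rep_x_zero : D.rep (D.x 0) = D.shift := D.lift_x _ _ _ _ _ 0

theorem rep_tailHom (a : D.tail.H) : D.rep (D.tailHom a) = D.lmul a :=
  DFunLike.congr_fun (D.tail.algHom_ext (f := D.rep.comp D.tailHom) (f' := D.lmul)
    (fun h => by rw [AlgHom.comp_apply, tailHom_grp]; exact D.lift_grp _ _ _ _ _ h)
    (fun j => by rw [AlgHom.comp_apply, tailHom_x]; exact D.lift_x _ _ _ _ _ j.succ)) a

theorem rep_surjective :
    Function.Surjective fun a : D.H => D.rep a (Pi.single 0 1 : ZMod (D.m 0) → D.tail.H) := by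
  intro v
  refine ⟨∑ r : ZMod (D.m 0), D.tailHom (v r) * D.x 0 ^ r.val, ?_⟩
  simp only [map_sum, map_mul, map_pow, rep_tailHom, rep_x_zero, LinearMap.sum_apply,
    Module.End.mul_apply]
  conv_rhs => rw [← Finset.univ_sum_single v]
  refine Finset.sum_congr rfl fun r _ => ?_
  rw [shift, skewShift_pow_single D.isSkewDerivation_skewDer (ZMod.val_lt r),
    ZMod.natCast_zmod_val, lmul, Algebra.lsmul_coe]
  simp only [← Pi.single_smul, smul_eq_mul, mul_one]

theorem tailDecomp_injective : Function.Injective D.tailDecomp := by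
  have hsurj : Function.Surjective ((LinearMap.applyₗ (Pi.single 0 1 : ZMod (D.m 0) → D.tail.H)
      ∘ₗ D.rep.toLinearMap) ∘ₗ D.tailDecomp) :=
    D.rep_surjective.comp D.tailDecomp_surjective
  have hinj := LinearMap.injective_iff_surjective.mpr hsurj
  rw [LinearMap.coe_comp] at hinj
  exact hinj.of_comp

/-- The decomposition `H = ⨁ y_0 ^ s H'` for `0 ≤ s < m_0`, as a linear equivalence. -/
noncomputable def tailDecompEquiv : (ZMod (D.m 0) → D.tail.H) ≃ₗ[k] D.H :=
  LinearEquiv.ofBijective D.tailDecomp ⟨D.tailDecomp_injective, D.tailDecomp_surjective⟩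

theorem tailDecompEquiv_symm_y_zero_pow_mul_tailHom (s : ZMod (D.m 0)) (a : D.tail.H) :
    D.tailDecompEquiv.symm (D.y 0 ^ s.val * D.tailHom a) = Pi.single s a := by
  rw [LinearEquiv.symm_apply_eq, ← tailDecomp_single]
  rfl

end rep

section basis

variable {k G : Type*} [Field k] [CommGroup G] [Finite G]

theorem exists_basis_monomial {n : ℕ} (D : LiftingDatum k G n) :
    ∃ b : Module.Basis ((∀ i, ZMod (D.m i)) × G) k D.H, ∀ r h, b (r, h) = D.monomial r h := by
  induction n with
  | zero =>
    exact ⟨D.zeroBasis.reindex (Equiv.uniqueProd G _).symm, fun r h => by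
      simp [monomial, zeroBasis_apply]⟩
  | succ n ih =>
    obtain ⟨b, hb⟩ := ih D.tail
    let e : (Σ _ : ZMod (D.m 0), (∀ i, ZMod (D.tail.m i)) × G) ≃ (∀ i, ZMod (D.m i)) × G :=
      (Equiv.sigmaEquivProd _ _).trans ((Equiv.prodAssoc _ _ _).symm.trans
        (Equiv.prodCongr (Fin.consEquiv fun i => ZMod (D.m i)) (Equiv.refl G)))
    refine ⟨((Pi.basis fun _ : ZMod (D.m 0) => b).map D.tailDecompEquiv).reindex e, fun r h => ?_⟩
    obtain ⟨⟨s, r', h'⟩, hr⟩ := e.surjective (r, h)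
    obtain ⟨rfl, rfl⟩ : Fin.cons s r' = r ∧ h' = h := Prod.ext_iff.mp hr
    rw [monomial_cons, ← hb, ← tailDecomp_single, ← hr, Module.Basis.reindex_apply,
      Equiv.symm_apply_apply, Module.Basis.map_apply, Pi.basis_apply]
    rfl

end basis

section comul

variable {k G : Type*} [Field k] [CommGroup G] [Finite G] {n : ℕ} (D : LiftingDatum k G n)

theorem comul_eq_comulHom (a : D.H) : Coalgebra.comul (R := k) a = D.comulHom a := rfl

theorem isGroupLikeElem_grp (h : G) : IsGroupLikeElem k (D.grp h) :=
  ⟨D.counitHom_grp h, D.comulHom_grp h⟩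

theorem comulHom_y (i : Fin n) :
    D.comulHom (D.y i) = D.y i ⊗ₜ[k] D.grp (D.g i)⁻¹ + 1 ⊗ₜ[k] D.y i := by
  rw [y, map_mul, comulHom_x, comulHom_grp, add_mul, Algebra.TensorProduct.tmul_mul_tmul,
    Algebra.TensorProduct.tmul_mul_tmul, grp_mul_grp_inv, one_mul, add_comm]

theorem comulHom_y_pow (i : Fin n) (r : ℕ) : D.comulHom (D.y i ^ r)
    = ∑ s ∈ Finset.range (r + 1), gaussBinom (D.q i i : k) r s •
      ((D.y i ^ s) ⊗ₜ[k] (D.grp ((D.g i)⁻¹ ^ s) * D.y i ^ (r - s))) := by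
  have hqcomm : ((1 : D.H) ⊗ₜ[k] D.y i) * (D.y i ⊗ₜ[k] D.grp (D.g i)⁻¹)
      = (D.q i i : k) • ((D.y i ⊗ₜ[k] D.grp (D.g i)⁻¹) * ((1 : D.H) ⊗ₜ[k] D.y i)) := by
    rw [Algebra.TensorProduct.tmul_mul_tmul, Algebra.TensorProduct.tmul_mul_tmul, one_mul,
      mul_one, ← TensorProduct.tmul_smul, grp_mul_y, smul_smul, map_inv (D.χ i), q,
      Units.mul_inv, one_smul]
  rw [map_pow, comulHom_y, qcomm_add_pow hqcomm]
  simp only [Algebra.TensorProduct.tmul_pow, Algebra.TensorProduct.tmul_mul_tmul, one_pow,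
    mul_one, map_pow]

end comul

section zero

variable {k G : Type*} [Field k] [CommGroup G] [Finite G] (D : LiftingDatum k G 0)

theorem exists_isRightIntegralDual_zero :
    ∃ φ : Module.Dual k D.H, φ ≠ 0 ∧ IsRightIntegralDual φ := by
  refine ⟨D.zeroBasis.coord 1, fun h => ?_, isTwistedIntegralDual_one_iff.mp <|
    isTwistedIntegralDual_of_basis D.zeroBasis fun h => ?_⟩
  · simpa using LinearMap.congr_fun h (D.zeroBasis 1)
  · rw [zeroBasis_apply, (D.isGroupLikeElem_grp h).comul_eq_tmul_self, contract_tmul,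
      ← zeroBasis_apply, Module.Basis.coord_apply, Module.Basis.repr_self]
    obtain rfl | hh := eq_or_ne h 1
    · rw [zeroBasis_apply, map_one D.grp, Finsupp.single_eq_same]
    · rw [Finsupp.single_eq_of_ne hh.symm, zero_smul, zero_smul]

end zero

section tail

variable {k G : Type*} [Field k] [CommGroup G] [Finite G] {n : ℕ} (D : LiftingDatum k G (n + 1))

theorem comulHom_tailHom (a : D.tail.H) : D.comulHom (D.tailHom a)
    = Algebra.TensorProduct.map D.tailHom D.tailHom (D.tail.comulHom a) :=
  DFunLike.congr_fun (D.tail.algHom_ext (f := D.comulHom.comp D.tailHom)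
    (f' := (Algebra.TensorProduct.map D.tailHom D.tailHom).comp D.tail.comulHom)
    (fun h => by simp) fun i => by simp) a

/-- The extension of a linear form `φ` on `H'` to `H = ⨁ y_0 ^ s H'` which sends
`y_0 ^ (m_0 - 1) a` to `φ a` and vanishes on the other summands. -/
noncomputable def topExtension (φ : Module.Dual k D.tail.H) : Module.Dual k D.H :=
  φ ∘ₗ LinearMap.proj (-1) ∘ₗ D.tailDecompEquiv.symm.toLinearMap

variable (φ : Module.Dual k D.tail.H)

theorem topExtension_y_zero_pow_mul_tailHom {r : ℕ} (hr : r < D.m 0) (a : D.tail.H) :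
    D.topExtension φ (D.y 0 ^ r * D.tailHom a) = if r = D.m 0 - 1 then φ a else 0 := by
  have hneg : (-1 : ZMod (D.m 0)) = r ↔ r = D.m 0 - 1 := by
    rw [eq_comm, eq_neg_iff_add_eq_zero, ← Nat.cast_add_one, ZMod.natCast_eq_zero_iff]
    exact ⟨fun h => by have := Nat.le_of_dvd r.succ_pos h; omega, fun h => ⟨1, by omega⟩⟩
  have hsymm := D.tailDecompEquiv_symm_y_zero_pow_mul_tailHom r a
  rw [ZMod.val_cast_of_lt hr] at hsymm
  simp only [topExtension, LinearMap.comp_apply, LinearEquiv.coe_coe, hsymm,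
    LinearMap.proj_apply, Pi.single_apply, hneg]
  split_ifs <;> simp

variable {φ}

theorem contract_topExtension_tmul_mul_comulHom_tailHom (hφ : IsRightIntegralDual φ) {r : ℕ}
    (hr : r < D.m 0) (c : D.H) (a : D.tail.H) :
    contract (D.topExtension φ) (((D.y 0 ^ r) ⊗ₜ[k] c) * D.comulHom (D.tailHom a))
      = D.topExtension φ (D.y 0 ^ r * D.tailHom a) • c := by
  have hcomp : (D.topExtension φ ∘ₗ LinearMap.mulLeft k (D.y 0 ^ r)) ∘ₗ D.tailHom.toLinearMap
      = if r = D.m 0 - 1 then φ else 0 := LinearMap.ext fun b =>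
    (D.topExtension_y_zero_pow_mul_tailHom φ hr b).trans (by split_ifs <;> rfl)
  have hmap := contract_map (D.topExtension φ ∘ₗ LinearMap.mulLeft k (D.y 0 ^ r))
    D.tailHom.toLinearMap D.tailHom.toLinearMap (Coalgebra.comul a)
  rw [hcomp] at hmap
  rw [contract_tmul_mul, comulHom_tailHom, topExtension_y_zero_pow_mul_tailHom D φ hr]
  refine (congrArg (c * ·) hmap).trans ?_
  split_ifs
  · simp [hφ.contract_comul]
  · simp [contract]

/-- Only the term `y_0 ^ (m_0 - 1) ⊗ g_0 ^ (1 - m_0)` of `Δ(y_0 ^ s)` survives. -/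
theorem contract_topExtension_comulHom_y_zero_pow_mul_tailHom (hφ : IsRightIntegralDual φ) {r : ℕ}
    (hr : r < D.m 0) (a : D.tail.H) :
    contract (D.topExtension φ) (D.comulHom (D.y 0 ^ r * D.tailHom a))
      = D.topExtension φ (D.y 0 ^ r * D.tailHom a) • D.grp ((D.g 0)⁻¹ ^ (D.m 0 - 1)) := by
  rw [map_mul, comulHom_y_pow, Finset.sum_mul, map_sum, Finset.sum_eq_single r]
  · rw [smul_mul_assoc, map_smul, D.contract_topExtension_tmul_mul_comulHom_tailHom hφ hr,
      gaussBinom_self, one_smul, Nat.sub_self, pow_zero, mul_one,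
      topExtension_y_zero_pow_mul_tailHom D φ hr]
    split_ifs with h
    · rw [h]
    · rw [zero_smul, zero_smul]
  · intro s hs hsr
    have hs_lt : s < r := lt_of_le_of_ne (Finset.mem_range_succ_iff.mp hs) hsr
    rw [smul_mul_assoc, map_smul,
      D.contract_topExtension_tmul_mul_comulHom_tailHom hφ (hs_lt.trans hr),
      topExtension_y_zero_pow_mul_tailHom D φ (hs_lt.trans hr), if_neg (by omega), zero_smul,
      smul_zero]
  · simp

theorem isTwistedIntegralDual_topExtension (hφ : IsRightIntegralDual φ) :
    IsTwistedIntegralDual (D.grp ((D.g 0)⁻¹ ^ (D.m 0 - 1))) (D.topExtension φ) := by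
  intro a
  obtain ⟨v, rfl⟩ := D.tailDecomp_surjective a
  rw [comul_eq_comulHom, tailDecomp_apply]
  simp only [map_sum, Finset.sum_smul,
    D.contract_topExtension_comulHom_y_zero_pow_mul_tailHom hφ (ZMod.val_lt _)]

end tail

variable {k G : Type*} [Field k] [CommGroup G] [Finite G]

theorem exists_isRightIntegralDual {n : ℕ} (D : LiftingDatum k G n) :
    ∃ φ : Module.Dual k D.H, φ ≠ 0 ∧ IsRightIntegralDual φ := by
  induction n with
  | zero => exact D.exists_isRightIntegralDual_zero
  | succ n ih =>
    obtain ⟨φ, hφ0, hφ⟩ := ih D.tail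
    have hu := D.isGroupLikeElem_grp ((D.g 0)⁻¹ ^ (D.m 0 - 1))
    rw [← MonoidHom.coe_toHomUnits] at hu
    refine (D.isTwistedIntegralDual_topExtension hφ).exists_isRightIntegralDual
      (u := D.grp.toHomUnits _) ?_ hu
    refine fun h => hφ0 (LinearMap.ext fun a => ?_)
    simpa [h] using (D.topExtension_y_zero_pow_mul_tailHom φ
      (Nat.sub_lt (D.m_pos 0) one_pos) a).symm

end LiftingDatum

theorem prod_ofFn_smul {M A : Type*} [CommMonoid M] [Monoid A] [MulAction M A]
    [IsScalarTower M A A] [SMulCommClass M A A] {n : ℕ} (c : Fin n → M) (a : Fin n → A) :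
    (List.ofFn fun i => c i • a i).prod = (∏ i, c i) • (List.ofFn a).prod := by
  induction n with
  | zero => simp
  | succ n ih =>
    rw [List.ofFn_succ, List.prod_cons, ih, List.ofFn_succ, List.prod_cons, Fin.prod_univ_succ,
      smul_mul_smul_comm]

namespace LiftingDatum

section nakayama

variable {k G : Type*} [Field k] [CommGroup G] [Finite G] {n : ℕ} (D : LiftingDatum k G n)

theorem isGroupLikeElem_toHomUnits_grp (h : G) :
    IsGroupLikeElem k (D.grp.toHomUnits h : D.H) :=
  D.isGroupLikeElem_grp h

theorem galoisMap_surjective : Function.Surjective (galoisMap k D.H) := by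
  refine galoisMap_surjective_of_adjoin_eq_top D.adjoin_generators ?_
  rintro _ (⟨h, rfl⟩ | ⟨i, rfl⟩)
  · exact tmul_one_mem_range_galoisMap_of_isGroupLikeElem (D.isGroupLikeElem_toHomUnits_grp h)
  · exact tmul_one_mem_range_galoisMap_of_comul_eq (D.isGroupLikeElem_toHomUnits_grp (D.g i))
      (D.comulHom_x i)

variable {D} {φ α : Module.Dual k D.H}

/-- The character `α(h)` of `G` given by a modular element `α`. -/
noncomputable def modularChar (hα : IsModularElement α) : G →* kˣ :=
  MonoidHom.toHomUnits
    { toFun h := α (D.grp h)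
      map_one' := by rw [map_one, hα.map_one]
      map_mul' h h' := by rw [map_mul, hα.map_mul] }

theorem val_modularChar (hα : IsModularElement α) (h : G) :
    (modularChar hα h : k) = α (D.grp h) := rfl

section

variable (hφ : IsRightIntegralDual φ) (hφ0 : φ ≠ 0) (hα : IsModularElement α)
  {ρ : D.H ≃ₐ[k] D.H} (hρ : IsNakayamaAut φ ρ)

include hφ hφ0 hα hρ

theorem nakayamaAut_grp (h : G) : ρ (D.grp h) = (modularChar hα h)⁻¹ • D.grp h := by
  refine (hφ.isFrobeniusHom hφ0 D.galoisMap_surjective).eq_of_forall_mul_eq fun z => ?_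
  have hcomm := hφ.apply_unit_mul hφ0 D.galoisMap_surjective hα
    (D.isGroupLikeElem_toHomUnits_grp h) z
  rw [MonoidHom.coe_toHomUnits] at hcomm
  rw [← hρ, smul_mul_assoc, Units.smul_def, map_smul, hcomm, ← val_modularChar hα, smul_eq_mul,
    Units.inv_mul_cancel_left]

theorem nakayamaAut_x (i : Fin n) :
    ρ (D.x i) = (D.q i i * modularChar hα (D.g i))⁻¹ • D.x i := by
  refine (hφ.isFrobeniusHom hφ0 D.galoisMap_surjective).eq_of_forall_mul_eq fun z => ?_
  have hcomm := hφ.apply_skewPrimitive_mul hφ0 D.galoisMap_surjective hα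
    (D.isGroupLikeElem_toHomUnits_grp (D.g i)) (Units.val_eq_one.not.mpr (D.χ_self_ne_one i))
    (D.comulHom_x i) (D.grp_mul_x (D.g i) i) z
  rw [MonoidHom.coe_toHomUnits] at hcomm
  rw [← hρ, smul_mul_assoc, Units.smul_def, map_smul, hcomm, ← val_modularChar hα, smul_eq_mul,
    ← q, ← Units.val_mul, Units.inv_mul_cancel_left]

theorem nakayamaAut_y (i : Fin n) : ρ (D.y i) = (D.q i i)⁻¹ • D.y i := by
  rw [y, map_mul, nakayamaAut_x hφ hφ0 hα hρ, nakayamaAut_grp hφ hφ0 hα hρ, smul_mul_smul_comm,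
    map_inv, inv_inv, mul_inv, inv_mul_cancel_right]

end

variable (D) in
/-- The character of `∏ ℤ/m_i × G` giving the eigenvalues of the Nakayama automorphism, for the
character `τ` of `G` given by the modular element. -/
noncomputable def nakayamaChar (τ : G →* kˣ) : Multiplicative (∀ i, ZMod (D.m i)) × G →* kˣ where
  toFun p := (∏ i, (D.q i i)⁻¹ ^ (p.1.toAdd i).val) * (τ p.2)⁻¹
  map_one' := by simp
  map_mul' p p' := by
    have hpow (i) : (D.q i i)⁻¹ ^ ((p * p').1.toAdd i).val
        = (D.q i i)⁻¹ ^ (p.1.toAdd i).val * (D.q i i)⁻¹ ^ (p'.1.toAdd i).val := by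
      have hmod := pow_mod_orderOf (D.q i i)⁻¹ ((p.1.toAdd i).val + (p'.1.toAdd i).val)
      rw [orderOf_inv] at hmod
      rw [Prod.fst_mul, toAdd_mul, Pi.add_apply, ZMod.val_add, ← pow_add]
      exact hmod
    simp only [hpow, Finset.prod_mul_distrib, Prod.snd_mul, map_mul, mul_inv]
    exact mul_mul_mul_comm _ _ _ _

variable (D) in
theorem nakayamaChar_apply (τ : G →* kˣ) (r : ∀ i, ZMod (D.m i)) (h : G) :
    D.nakayamaChar τ (Multiplicative.ofAdd r, h)
      = (∏ i, (D.q i i)⁻¹ ^ (r i).val) * (τ h)⁻¹ := rfl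

theorem nakayamaAut_monomial (hφ : IsRightIntegralDual φ) (hφ0 : φ ≠ 0)
    (hα : IsModularElement α) {ρ : D.H ≃ₐ[k] D.H} (hρ : IsNakayamaAut φ ρ)
    (r : ∀ i, ZMod (D.m i)) (h : G) :
    ρ (D.monomial r h)
      = (D.nakayamaChar (modularChar hα) (Multiplicative.ofAdd r, h) : k) • D.monomial r h := by
  have hfactor (i) : ρ ((D.x i * D.grp (D.g i)⁻¹) ^ (r i).val)
      = (D.q i i)⁻¹ ^ (r i).val • (D.x i * D.grp (D.g i)⁻¹) ^ (r i).val := by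
    rw [map_pow, ← y, nakayamaAut_y hφ hφ0 hα hρ, smul_pow]
  rw [← Units.smul_def, nakayamaChar_apply, monomial, map_mul, map_list_prod, List.map_ofFn,
    nakayamaAut_grp hφ hφ0 hα hρ]
  simp only [Function.comp_def, hfactor]
  rw [prod_ofFn_smul (fun i => (D.q i i)⁻¹ ^ (r i).val), smul_mul_smul_comm]

theorem range_nakayamaChar (τ : G →* kˣ) : (D.nakayamaChar τ).range
    = Subgroup.closure ((Set.range fun i => D.q i i) ∪ Set.range τ) := by
  refine le_antisymm ?_ ((Subgroup.closure_le _).mpr ?_)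
  · rintro _ ⟨⟨r, h⟩, rfl⟩
    refine mul_mem (prod_mem fun i _ => pow_mem (inv_mem ?_) _) (inv_mem ?_)
    · exact Subgroup.subset_closure (.inl ⟨i, rfl⟩)
    · exact Subgroup.subset_closure (.inr ⟨h, rfl⟩)
  · rintro _ (⟨i, rfl⟩ | ⟨h, rfl⟩)
    · have : Fact (1 < D.m i) := ⟨D.one_lt_m i⟩
      refine inv_mem_iff.mp ⟨(Multiplicative.ofAdd (Pi.single i 1), 1), ?_⟩
      rw [nakayamaChar_apply, map_one, inv_one, mul_one,
        Finset.prod_eq_single i (fun j _ hj => by simp [hj]) (by simp), Pi.single_eq_same,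
        ZMod.val_one, pow_one]
    · exact inv_mem_iff.mp
        ⟨(Multiplicative.ofAdd 0, h), (D.nakayamaChar_apply τ 0 h).trans (by simp)⟩

theorem L₁_eq_range_nakayamaChar (hα : IsModularElement α) :
    D.L₁ α = (D.nakayamaChar (modularChar hα)).range := by
  rw [range_nakayamaChar, L₁]
  congr 2
  ext u
  simp [← val_modularChar hα, Units.val_inj, eq_comm]

end nakayama

end LiftingDatum

theorem mainTheorem7 {k G : Type*} [Field k] [CommGroup G] [Finite G] {n : ℕ}
    (D : LiftingDatum k G n) :
    -- nonzero right integrals in the dual of `H`, and the modular element, exist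
    (∃ φ : Module.Dual k D.H, φ ≠ 0 ∧ IsRightIntegralDual φ) ∧
    (∃ α : Module.Dual k D.H, IsModularElement α) ∧
    -- the given elements form a basis of `H`
    (∃ b : Module.Basis ((∀ i, ZMod (D.m i)) × G) k D.H, ∀ r h, b (r, h) = D.monomial r h) ∧
    ∀ φ : Module.Dual k D.H, φ ≠ 0 → IsRightIntegralDual φ →
      -- the Nakayama automorphism is well defined
      IsFrobeniusHom φ ∧ (∃! ρ : D.H ≃ₐ[k] D.H, IsNakayamaAut φ ρ) ∧
      ∀ ρ : D.H ≃ₐ[k] D.H, IsNakayamaAut φ ρ →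
        -- the basis elements are eigenvectors, with eigenvalues given by a homomorphism
        (∃ θ : Multiplicative (∀ i, ZMod (D.m i)) × G →* kˣ, ∀ r h,
          ρ (D.monomial r h) = (θ (Multiplicative.ofAdd r, h) : k) • D.monomial r h) ∧
        ∀ α : Module.Dual k D.H, IsModularElement α →
          -- `L₁` is the set of eigenvalues, `H` is the direct sum of the components,
          -- and these all have the same dimension
          (∀ z : k, D.component ρ z ≠ ⊥ ↔ ∃ ω ∈ D.L₁ α, (ω : k) = z) ∧
          iSupIndep (fun ω : D.L₁ α => D.component ρ ((ω : kˣ) : k)) ∧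
          (⨆ ω : D.L₁ α, D.component ρ ((ω : kˣ) : k)) = ⊤ ∧
          ∀ ω ∈ D.L₁ α, ∀ ω' ∈ D.L₁ α,
            Module.finrank k (D.component ρ (ω : k)) = Module.finrank k (D.component ρ (ω' : k)) := by
  obtain ⟨φ₀, hφ₀_ne, hφ₀⟩ := D.exists_isRightIntegralDual
  obtain ⟨α₀, hα₀⟩ :=
    (hφ₀.isFrobeniusHom hφ₀_ne D.galoisMap_surjective).exists_isModularElement
  obtain ⟨b, hb⟩ := D.exists_basis_monomial
  refine ⟨⟨φ₀, hφ₀_ne, hφ₀⟩, ⟨α₀, hα₀⟩, ⟨b, hb⟩, fun φ hφ0 hφ => ?_⟩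
  have hF := hφ.isFrobeniusHom hφ0 D.galoisMap_surjective
  refine ⟨hF, hF.existsUnique_isNakayamaAut, fun ρ hρ =>
    ⟨⟨_, LiftingDatum.nakayamaAut_monomial hφ hφ0 hα₀ hρ⟩, fun α hα => ?_⟩⟩
  let b' := b.reindex (Equiv.prodCongr Multiplicative.ofAdd (Equiv.refl G))
  have hb' (p) : (ρ : D.H →ₗ[k] D.H) (b' p)
      = (D.nakayamaChar (LiftingDatum.modularChar hα) p : k) • b' p := by
    simpa [b', hb] using LiftingDatum.nakayamaAut_monomial hφ hφ0 hα hρ p.1.toAdd p.2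
  rw [LiftingDatum.L₁_eq_range_nakayamaChar hα]
  refine ⟨fun z => ?_, ?_, ?_, ?_⟩
  · simpa [LiftingDatum.component] using eigenspace_ne_bot_iff_of_basis hb' z
  · exact (Module.End.eigenspaces_iSupIndep (ρ : D.H →ₗ[k] D.H)).comp
      (Units.val_injective.comp Subtype.val_injective)
  · exact (iSup_range' (fun ω : kˣ => D.component ρ ω) _).trans
      (iSup_eigenspace_eq_top_of_basis hb')
  · rintro _ ⟨p, rfl⟩ _ ⟨p', rfl⟩
    exact (finrank_eigenspace_of_character hb' p).trans
      (finrank_eigenspace_of_character hb' p').symm
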